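/- Let $\mathcal T_2$ be the infinite tree all of whose vertices have valency 3, realized as the tree dual to the Farey triangulation: its vertices are the Farey triangles, i.e. the images of $\{0,1,\infty\}\subset\mathbb{RP}^1$ under $\mathrm{PSL}(2,\mathbb Z)$, and two triangles are adjacent if they have a common side. Let $\mathrm{Abs}(\mathcal T_2)$ be its boundary (classes of non-backtracking infinite paths, two paths being equivalent if they eventually coincide up to a shift), with the topology generated by the balls (a ball is the set of ends of one of the two pieces obtained by cutting the tree at the middle of an edge). Let $\mathrm{Hier}(\mathcal T_2)$ be the group of spheromorphisms, i.e. of homeomorphisms of $\mathrm{Abs}(\mathcal T_2)$ coinciding with an automorphism of the tree in a neighbourhood of each point; it contains $\mathrm{Aut}(\mathcal T_2)$ and carries the group topology for which $\mathrm{Aut}(\mathcal T_2)$, with its usual topology (pointwise stabilizers of finite sets of vertices form a basis of neighbourhoods of the identity), is an open subgroup. Let $\mathrm{Th}$ be the Thompson group, realized as the discrete group of all homeomorphisms $f$ of $\mathbb{RP}^1$ for which there is a finite set $F\subset\mathbb Q\cup\{\infty\}$ such that $f$ coincides with an element of $\mathrm{PSL}(2,\mathbb Z)$ on each arc of $\mathbb{RP}^1\setminus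 F$; it contains $\mathrm{PSL}(2,\mathbb Z)$. For a topological group $G$ and a subgroup $K$, a $K$-spherical representation of $G$ with spherical vector $v$ is an irreducible strongly continuous unitary representation of $G$ in a complex Hilbert space such that $v$ is a nonzero $K$-fixed vector and any $K$-fixed vector is proportional to $v$. Say that $\xi\in\mathrm{Abs}(\mathcal T_2)$ lies over $p\in\mathbb{RP}^1$ if the triangles of a path representing $\xi$ shrink to $p$. Then $\mathrm{Th}$ is embedded in $\mathrm{Hier}(\mathcal T_2)$: there is an injective homomorphism $\iota:\mathrm{Th}\to\mathrm{Hier}(\mathcal T_2)$ such that $\iota(f)\xi$ lies over $f(p)$ whenever $\xi$ lies over $p$, and $\iota(\mathrm{PSL}(2,\mathbb Z))\subset\mathrm{Aut}(\mathcal T_2)$. For this embedding the following holds: let $\rho$ be an $\mathrm{Aut}(\mathcal T_2)$-spherical unitary representation of $\mathrm{Hier}(\mathcal T_2)$ with spherical vector $v$. Then the $\mathrm{Th}$-cyclic span of $v$ (the closed linear span of the vectors $\rho(\iota(f))v$, $f\in\mathrm{Th}$) is a $\mathrm{PSL}(2,\mathbb Z)$-spherical representation of $\mathrm{Th}$, with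 spherical vector $v$. -/

import Mathlib

open Filter Topology
open scoped MatrixGroups

/-! ## Trees, their boundaries and their spheromorphisms -/

section Boundary

variable {V : Type*}

/-- A way in a graph: a sequence of vertices, consecutive ones adjacent, without backtracking. -/
def Way (T : SimpleGraph V) : Type _ :=
  {a : ℕ → V // (∀ i, T.Adj (a i) (a (i + 1))) ∧ ∀ i, a (i + 2) ≠ a i}

/-- Two ways are equivalent if they eventually coincide up to a shift of the numbering. -/
def waySetoid (T : SimpleGraph V) : Setoid (Way T) where
  r a b := ∃ m n : ℕ, ∀ i, a.1 (m + i) = b.1 (n + i)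
  iseqv :=
    { refl := fun _ => ⟨0, 0, fun _ => rfl⟩
      symm := fun ⟨m, n, h⟩ => ⟨n, m, fun i => (h i).symm⟩
      trans := by
        rintro a b c ⟨m, n, h⟩ ⟨m', n', h'⟩
        refine ⟨m + m', n' + n, fun i => ?_⟩
        rw [add_assoc, h, add_assoc, ← h', ← add_assoc, ← add_assoc, add_comm n m'] }

/-- The boundary `Abs(T)`: classes of equivalent ways. -/
def Abs (T : SimpleGraph V) : Type _ := Quotient (waySetoid T)

/-- The point of the boundary determined by a way. -/
def Way.toAbs {T : SimpleGraph V} (a : Way T) : Abs T := Quotient.mk (waySetoid T) a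

/-- The branch containing `w` of the graph cut at the middle of the edge `{u, w}`. -/
def branch (T : SimpleGraph V) (u w : V) : Set V :=
  {x | (T.deleteEdges {s(u, w)}).Reachable w x}

/-- The ball in the boundary: classes of ways lying in the branch. -/
def ball (T : SimpleGraph V) (u w : V) : Set (Abs T) :=
  {ξ | ∃ a : Way T, a.toAbs = ξ ∧ ∀ i, a.1 i ∈ branch T u w}

/-- The topology of the boundary, generated by the balls (for a tree, the complement of a ball
is the opposite ball, so balls are clopen). -/
instance (T : SimpleGraph V) : TopologicalSpace (Abs T) :=
  TopologicalSpace.generateFrom {B | ∃ u w, T.Adj u w ∧ B = ball T u w}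

/-- The image of a way under an automorphism. -/
def Way.map {T : SimpleGraph V} (r : T ≃g T) (a : Way T) : Way T :=
  ⟨fun i => r (a.1 i), fun i => r.map_adj_iff.2 (a.2.1 i), fun i h => a.2.2 i (r.injective h)⟩

/-- The action of an automorphism on the boundary. -/
def absMap {T : SimpleGraph V} (r : T ≃g T) : Abs T → Abs T :=
  Quotient.map (Way.map r) fun _ _ ⟨m, n, h⟩ => ⟨m, n, fun i => congrArg r (h i)⟩

theorem absMap_one {T : SimpleGraph V} (ξ : Abs T) : absMap (1 : T ≃g T) ξ = ξ := by
  induction ξ using Quotient.inductionOn; rfl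

theorem absMap_mul {T : SimpleGraph V} (r s : T ≃g T) (ξ : Abs T) :
    absMap (r * s) ξ = absMap r (absMap s ξ) := by
  induction ξ using Quotient.inductionOn; rfl

theorem branch_map {T : SimpleGraph V} (r : T ≃g T) {u w x : V} (h : x ∈ branch T u w) :
    r x ∈ branch T (r u) (r w) := by
  let f : T.deleteEdges {s(u, w)} →g T.deleteEdges {s(r u, r w)} :=
    { toFun := r
      map_rel' := by
        intro a b hab
        rw [SimpleGraph.deleteEdges_adj] at hab ⊢
        refine ⟨r.map_adj_iff.2 hab.1, fun hh => hab.2 ?_⟩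
        have hinj : Function.Injective (Sym2.map r) := Sym2.map.injective r.injective
        exact hinj (by simpa using hh) }
  exact SimpleGraph.Reachable.map f h

theorem ball_map {T : SimpleGraph V} (r : T ≃g T) {u w : V} {ξ : Abs T} (h : ξ ∈ ball T u w) :
    absMap r ξ ∈ ball T (r u) (r w) := by
  obtain ⟨a, rfl, ha⟩ := h
  exact ⟨a.map r, rfl, fun i => branch_map r (ha i)⟩

theorem continuous_absMap {T : SimpleGraph V} (r : T ≃g T) : Continuous (absMap r) := by
  refine continuous_generateFrom_iff.2 ?_
  rintro _ ⟨u, w, huw, rfl⟩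
  have : absMap r ⁻¹' ball T u w = ball T (r⁻¹ u) (r⁻¹ w) := by
    ext ξ
    constructor
    · intro h
      have := ball_map r⁻¹ h
      rwa [← absMap_mul, inv_mul_cancel, absMap_one] at this
    · intro h
      simpa using ball_map r h
  rw [this]
  exact TopologicalSpace.isOpen_generateFrom_of_mem ⟨_, _, r⁻¹.map_adj_iff.2 huw, rfl⟩

/-- The action of `Aut(T)` on the boundary by homeomorphisms. -/
def absHomeo (T : SimpleGraph V) : (T ≃g T) →* (Abs T ≃ₜ Abs T) where
  toFun r :=
    { toFun := absMap r
      invFun := absMap r⁻¹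
      left_inv := fun ξ => by rw [← absMap_mul, inv_mul_cancel, absMap_one]
      right_inv := fun ξ => by rw [← absMap_mul, mul_inv_cancel, absMap_one]
      continuous_toFun := continuous_absMap r
      continuous_invFun := continuous_absMap r⁻¹ }
  map_one' := Homeomorph.ext absMap_one
  map_mul' r s := Homeomorph.ext (absMap_mul r s)

/-- The group `Hier(T)` of spheromorphisms: homeomorphisms of the boundary that coincide with an
automorphism of the tree in a neighbourhood of each point. -/
def hier (T : SimpleGraph V) : Subgroup (Abs T ≃ₜ Abs T) where
  carrier := {q | ∀ ξ, ∃ r : T ≃g T, ∀ᶠ η in 𝓝 ξ, q η = absHomeo T r η}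
  one_mem' ξ := ⟨1, by simp⟩
  mul_mem' := by
    intro p q hp hq ξ
    obtain ⟨s, hs⟩ := hq ξ
    obtain ⟨r, hr⟩ := hp (q ξ)
    refine ⟨r * s, ?_⟩
    filter_upwards [hs, q.continuous.continuousAt.eventually hr] with η h1 h2
    rw [map_mul, Homeomorph.mul_apply, Homeomorph.mul_apply, h2, h1]
  inv_mem' := by
    intro q hq ξ
    obtain ⟨r, hr⟩ := hq (q.symm ξ)
    refine ⟨r⁻¹, ?_⟩
    filter_upwards [q.symm.continuous.continuousAt.eventually hr] with η h
    rw [Homeomorph.apply_symm_apply] at h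
    rw [map_inv, Homeomorph.inv_apply, Homeomorph.inv_apply, Homeomorph.eq_symm_apply]
    exact h.symm

/-- The inclusion `Aut(T) → Hier(T)`. -/
def autToHier (T : SimpleGraph V) : (T ≃g T) →* hier T :=
  (absHomeo T).codRestrict (hier T) fun r _ => ⟨r, Eventually.of_forall fun _ => rfl⟩

/-- The group `Aut(T)` as a subgroup of `Hier(T)`. -/
def autSubgroup (T : SimpleGraph V) : Subgroup (hier T) := (autToHier T).range

/-- The topology of `Hier(T)`: the pointwise stabilizers in `Aut(T)` of finite sets of vertices
form a basis of neighbourhoods of the identity. In particular, `Aut(T)` is open. -/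
instance (T : SimpleGraph V) : TopologicalSpace (hier T) where
  IsOpen U := ∀ g ∈ U, ∃ S : Finset V, ∀ r : T ≃g T, (∀ x ∈ S, r x = x) → g * autToHier T r ∈ U
  isOpen_univ := fun _ _ => ⟨∅, fun _ _ => trivial⟩
  isOpen_inter := by
    classical
    intro U U' h h' g hg
    obtain ⟨S, hS⟩ := h g hg.1
    obtain ⟨S', hS'⟩ := h' g hg.2
    exact ⟨S ∪ S', fun r hr => ⟨hS r fun x hx => hr x (Finset.mem_union_left _ hx),
      hS' r fun x hx => hr x (Finset.mem_union_right _ hx)⟩⟩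
  isOpen_sUnion := by
    rintro 𝒰 h g ⟨U, hU, hg⟩
    obtain ⟨S, hS⟩ := h U hU g hg
    exact ⟨S, fun r hr => ⟨U, hU, hS r hr⟩⟩

end Boundary

/-! ## Unitary representations -/

section Representations

variable {G : Type*} [Group G]
variable {H : Type*} [NormedAddCommGroup H] [InnerProductSpace ℂ H]

/-- A subspace is invariant under a unitary representation. -/
def InvariantUnder (ρ : G →* (H ≃ₗᵢ[ℂ] H)) (W : Submodule ℂ H) : Prop :=
  ∀ g, ∀ w ∈ W, ρ g w ∈ W

/-- The homomorphism `ρ` of the topological group `G` to the unitary group of the Hilbert space `H`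
is an (irreducible, strongly continuous) `K`-spherical unitary representation with spherical
vector `v`: the vector `v` is nonzero and `K`-fixed, and any `K`-fixed vector is a multiple
of `v`. -/
structure IsSpherical [TopologicalSpace G] [CompleteSpace H] (ρ : G →* (H ≃ₗᵢ[ℂ] H))
    (K : Subgroup G) (v : H) : Prop where
  continuous : ∀ w : H, Continuous fun g => ρ g w
  irreducible : ∀ W : Submodule ℂ H, IsClosed (W : Set H) → InvariantUnder ρ W → W = ⊥ ∨ W = ⊤
  ne_zero : v ≠ 0
  fixed : ∀ k ∈ K, ρ k v = v
  unique : ∀ w : H, (∀ k ∈ K, ρ k w = w) → ∃ c : ℂ, w = c • v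

/-- The `G`-cyclic span of a vector: the closed linear span of its orbit. -/
def cyclicSpan (ρ : G →* (H ≃ₗᵢ[ℂ] H)) (v : H) : Submodule ℂ H :=
  (Submodule.span ℂ (Set.range fun g => ρ g v)).topologicalClosure

instance [CompleteSpace H] (ρ : G →* (H ≃ₗᵢ[ℂ] H)) (v : H) : CompleteSpace (cyclicSpan ρ v) :=
  Submodule.topologicalClosure.completeSpace _

theorem invariantUnder_cyclicSpan (ρ : G →* (H ≃ₗᵢ[ℂ] H)) (v : H) :
    InvariantUnder ρ (cyclicSpan ρ v) := by
  intro g w hw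
  have hmaps : Set.MapsTo (ρ g) (Submodule.span ℂ (Set.range fun g => ρ g v) : Set H)
      (Submodule.span ℂ (Set.range fun g => ρ g v) : Set H) := by
    intro x hx
    induction hx using Submodule.span_induction with
    | mem x hx =>
      obtain ⟨k, rfl⟩ := hx
      exact Submodule.subset_span ⟨g * k, by simp⟩
    | zero => simp
    | add x y _ _ hx hy => rw [map_add]; exact Submodule.add_mem _ hx hy
    | smul c x _ hx => rw [map_smul]; exact Submodule.smul_mem _ _ hx
  exact hmaps.closure (ρ g).continuous hw

theorem mem_cyclicSpan (ρ : G →* (H ≃ₗᵢ[ℂ] H)) (v : H) : v ∈ cyclicSpan ρ v :=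
  Submodule.le_topologicalClosure _ (Submodule.subset_span ⟨1, by simp⟩)

/-- The representation of `G` in the cyclic span of a vector. -/
def cyclicRep (ρ : G →* (H ≃ₗᵢ[ℂ] H)) (v : H) :
    G →* (cyclicSpan ρ v ≃ₗᵢ[ℂ] cyclicSpan ρ v) where
  toFun g :=
    { toFun := fun w => ⟨ρ g w, invariantUnder_cyclicSpan ρ v g w w.2⟩
      invFun := fun w => ⟨ρ g⁻¹ w, invariantUnder_cyclicSpan ρ v g⁻¹ w w.2⟩
      left_inv := fun w => Subtype.ext (by simp)
      right_inv := fun w => Subtype.ext (by simp)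
      map_add' := fun w w' => Subtype.ext (by simp)
      map_smul' := fun c w => Subtype.ext (by simp)
      norm_map' := fun w => (ρ g).norm_map w }
  map_one' := LinearIsometryEquiv.ext fun w => Subtype.ext (by simp)
  map_mul' g k := LinearIsometryEquiv.ext fun w => Subtype.ext (by simp)

end Representations

/-! ## The Thompson group -/

section Thompson

/-- The real projective line `ℝ ∪ {∞}`. -/
abbrev RP1 : Type := OnePoint ℝ

/-- The fractional linear transformation of the real projective line given by a matrix. -/
noncomputable def moebius (A : SL(2, ℤ)) (x : RP1) : RP1 :=
  Matrix.SpecialLinearGroup.mapGL ℝ A • x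

theorem moebius_one (x : RP1) : moebius 1 x = x := by simp [moebius]

theorem moebius_mul (A B : SL(2, ℤ)) (x : RP1) :
    moebius (A * B) x = moebius A (moebius B x) := by simp [moebius, mul_smul]

theorem mapGL_apply (A : SL(2, ℤ)) (i j : Fin 2) :
    (Matrix.SpecialLinearGroup.mapGL ℝ A : GL (Fin 2) ℝ) i j = ((A i j : ℤ) : ℝ) := by
  rw [Matrix.SpecialLinearGroup.mapGL_coe_matrix]
  rfl

theorem moebius_coe (A : SL(2, ℤ)) (x : ℝ) : moebius A (x : RP1) =
    if (A 1 0 : ℝ) * x + A 1 1 = 0 then OnePoint.infty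
    else (((A 0 0 * x + A 0 1) / (A 1 0 * x + A 1 1) : ℝ) : RP1) := by
  simp only [moebius, OnePoint.smul_some_eq_ite, mapGL_apply]

theorem moebius_infty (A : SL(2, ℤ)) : moebius A OnePoint.infty =
    if (A 1 0 : ℝ) = 0 then OnePoint.infty else (((A 0 0 : ℝ) / A 1 0 : ℝ) : RP1) := by
  simp only [moebius, OnePoint.smul_infty_eq_ite, mapGL_apply]

theorem moebius_T_coe (x : ℝ) : moebius ModularGroup.T (x : RP1) = ((x + 1 : ℝ) : RP1) := by
  rw [moebius_coe]; simp [ModularGroup.T]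

theorem moebius_T_infty : moebius ModularGroup.T OnePoint.infty = OnePoint.infty := by
  rw [moebius_infty]; simp [ModularGroup.T]

theorem moebius_S_coe (x : ℝ) : moebius ModularGroup.S (x : RP1) =
    if x = 0 then OnePoint.infty else ((-x⁻¹ : ℝ) : RP1) := by
  rw [moebius_coe]; simp [ModularGroup.S, neg_div]

theorem moebius_S_infty : moebius ModularGroup.S OnePoint.infty = ((0 : ℝ) : RP1) := by
  rw [moebius_infty]; simp [ModularGroup.S]

theorem continuous_moebius_T : Continuous (moebius ModularGroup.T) := by
  have h : moebius ModularGroup.T = OnePoint.map fun x : ℝ => x + 1 := by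
    funext x
    induction x using OnePoint.rec with
    | infty => exact moebius_T_infty
    | coe x => exact moebius_T_coe x
  rw [h]
  refine OnePoint.continuous_map (by fun_prop) ?_
  rw [Filter.coclosedCompact_eq_cocompact]
  exact (Homeomorph.addRight (1 : ℝ)).isClosedEmbedding.tendsto_cocompact

theorem continuous_moebius_S : Continuous (moebius ModularGroup.S) := by
  rw [continuous_iff_continuousAt]
  intro x
  induction x using OnePoint.rec with
  | infty =>
    rw [OnePoint.continuousAt_infty', moebius_S_infty, Filter.coclosedCompact_eq_cocompact,
      ← Metric.cobounded_eq_cocompact]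
    have h : Tendsto (fun x : ℝ => ((-x⁻¹ : ℝ) : RP1)) (Bornology.cobounded ℝ)
        (𝓝 ((0 : ℝ) : RP1)) := by
      refine (OnePoint.continuous_coe.tendsto (0 : ℝ)).comp ?_
      simpa using (tendsto_inv₀_cobounded (α := ℝ)).neg
    refine h.congr' ?_
    filter_upwards [Bornology.eventually_ne_cobounded (0 : ℝ)] with x hx
    simp [moebius_S_coe, hx]
  | coe x =>
    rw [OnePoint.continuousAt_coe]
    by_cases hx : x = 0
    · subst hx
      rw [continuousAt_iff_punctured_nhds]
      have h : Tendsto (fun x : ℝ => ((-x⁻¹ : ℝ) : RP1)) (𝓝[≠] 0) (𝓝 OnePoint.infty) := by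
        refine OnePoint.tendsto_coe_infty.comp ?_
        rw [Filter.coclosedCompact_eq_cocompact, ← Metric.cobounded_eq_cocompact]
        exact (Filter.tendsto_neg_cobounded (E := ℝ)).comp tendsto_inv₀_nhdsNE_zero
      simp only [Function.comp_apply, moebius_S_coe, if_true]
      refine h.congr' ?_
      filter_upwards [self_mem_nhdsWithin] with y hy
      simp [moebius_S_coe, show y ≠ 0 from hy]
    · have h : ContinuousAt (fun x : ℝ => ((-x⁻¹ : ℝ) : RP1)) x :=
        OnePoint.continuous_coe.continuousAt.comp (continuousAt_inv₀ hx).neg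
      refine h.congr ?_
      filter_upwards [isOpen_ne.mem_nhds hx] with y hy
      simp [moebius_S_coe, show y ≠ 0 from hy]

theorem continuous_moebius (A : SL(2, ℤ)) : Continuous (moebius A) := by
  have hA : A ∈ Subgroup.closure {ModularGroup.S, ModularGroup.T} := by
    rw [SpecialLinearGroup.SL2Z_generators]; trivial
  induction hA using Subgroup.closure_induction with
  | mem A hA =>
    rcases hA with rfl | rfl
    · exact continuous_moebius_S
    · exact continuous_moebius_T
  | one => exact continuous_id.congr fun x => (moebius_one x).symm
  | mul A B _ _ hA hB => exact (hA.comp hB).congr fun x => (moebius_mul A B x).symm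
  | inv A _ hA =>
    let e : RP1 ≃ RP1 :=
      { toFun := moebius A
        invFun := moebius A⁻¹
        left_inv := fun x => by rw [← moebius_mul, inv_mul_cancel, moebius_one]
        right_inv := fun x => by rw [← moebius_mul, mul_inv_cancel, moebius_one] }
    exact (Continuous.homeoOfEquivCompactToT2 (f := e) hA).symm.continuous

/-- The action of `SL(2, ℤ)` on the real projective line. -/
noncomputable def moebiusHom : SL(2, ℤ) →* (RP1 ≃ₜ RP1) where
  toFun A :=
    { toFun := moebius A
      invFun := moebius A⁻¹
      left_inv := fun x => by rw [← moebius_mul, inv_mul_cancel, moebius_one]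
      right_inv := fun x => by rw [← moebius_mul, mul_inv_cancel, moebius_one]
      continuous_toFun := continuous_moebius A
      continuous_invFun := continuous_moebius A⁻¹ }
  map_one' := Homeomorph.ext moebius_one
  map_mul' A B := Homeomorph.ext (moebius_mul A B)

/-- The group `PSL(2, ℤ)`, as the group of transformations of the real projective line. -/
noncomputable def modularSubgroup : Subgroup (RP1 ≃ₜ RP1) := moebiusHom.range

/-- The rational points `ℚ ∪ {∞}` of the real projective line. -/
def rationalPoints : Set RP1 := Set.range (OnePoint.map (Rat.cast : ℚ → ℝ))

theorem moebius_mem_rationalPoints (A : SL(2, ℤ)) {x : RP1} (hx : x ∈ rationalPoints) :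
    moebius A x ∈ rationalPoints := by
  unfold rationalPoints at hx ⊢
  rw [← isCusp_SL2Z_iff, isCusp_SL2Z_iff'] at hx ⊢
  obtain ⟨g, rfl⟩ := hx
  exact ⟨A * g, by rw [moebius, ← mul_smul, map_mul]⟩

/-- A homeomorphism of the real projective line is piecewise `PSL(2, ℤ)` if, outside a finite set
of rational points, it coincides with an element of `PSL(2, ℤ)` on each arc. -/
def IsPiecewisePSL (f : RP1 ≃ₜ RP1) : Prop :=
  ∃ F : Set RP1, F.Finite ∧ F ⊆ rationalPoints ∧
    ∀ J : Set RP1, IsPreconnected J → Disjoint J F → ∃ A : SL(2, ℤ), ∀ x ∈ J, f x = moebius A x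

theorem exists_arc (F : Set RP1) (hF : F.Finite) (x : RP1) :
    ∃ J : Set RP1, IsPreconnected J ∧ Disjoint J F ∧ x ∈ closure J := by
  induction x using OnePoint.rec with
  | infty =>
    have hF' : (((↑) : ℝ → RP1) ⁻¹' F).Finite := hF.preimage OnePoint.coe_injective.injOn
    obtain ⟨M, hM⟩ := hF'.bddAbove
    refine ⟨(↑) '' Set.Ioi M, isPreconnected_Ioi.image _ OnePoint.continuous_coe.continuousOn,
      ?_, ?_⟩
    · rw [Set.disjoint_left]
      rintro _ ⟨y, hy, rfl⟩ hyF
      exact absurd (hM hyF) (not_le.2 hy)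
    · have ht : Tendsto ((↑) : ℝ → RP1) atTop (𝓝 OnePoint.infty) := by
        refine OnePoint.tendsto_coe_infty.mono_left ?_
        rw [Filter.coclosedCompact_eq_cocompact]
        exact atTop_le_cocompact
      refine mem_closure_of_tendsto ht ?_
      filter_upwards [eventually_gt_atTop M] with y hy using ⟨y, hy, rfl⟩
  | coe x =>
    have hF' : ((((↑) : ℝ → RP1) ⁻¹' F) \ {x}).Finite :=
      (hF.preimage OnePoint.coe_injective.injOn).subset Set.sdiff_subset
    obtain ⟨ε, hε, hball⟩ := Metric.isOpen_iff.1 hF'.isClosed.isOpen_compl x (by simp)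
    refine ⟨(↑) '' Set.Ioo x (x + ε),
      isPreconnected_Ioo.image _ OnePoint.continuous_coe.continuousOn, ?_, ?_⟩
    · rw [Set.disjoint_left]
      rintro _ ⟨y, hy, rfl⟩ hyF
      refine hball (?_ : y ∈ Metric.ball x ε) ⟨hyF, fun h => hy.1.ne' h⟩
      rw [Real.ball_eq_Ioo]
      exact ⟨by linarith [hy.1], hy.2⟩
    · refine image_closure_subset_closure_image OnePoint.continuous_coe ⟨x, ?_, rfl⟩
      rw [closure_Ioo (by linarith)]
      exact ⟨le_rfl, by linarith⟩

theorem IsPiecewisePSL.exists_eq {f : RP1 ≃ₜ RP1} (hf : IsPiecewisePSL f) (x : RP1) :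
    ∃ A : SL(2, ℤ), f x = moebius A x := by
  obtain ⟨F, hF, -, h⟩ := hf
  obtain ⟨J, hJ, hJF, hx⟩ := exists_arc F hF x
  obtain ⟨A, hA⟩ := h J hJ hJF
  exact ⟨A, closure_minimal (t := {y | f y = moebius A y}) hA
    (isClosed_eq f.continuous (continuous_moebius A)) hx⟩

/-- The Thompson group: all continuous piecewise `PSL(2, ℤ)`-transformations of the real
projective line. -/
def thompson : Subgroup (RP1 ≃ₜ RP1) where
  carrier := {f | IsPiecewisePSL f}
  one_mem' := ⟨∅, Set.finite_empty, Set.empty_subset _,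
    fun _ _ _ => ⟨1, fun x _ => (moebius_one x).symm⟩⟩
  mul_mem' := by
    rintro f g ⟨F, hF, hFQ, h⟩ hg
    have hg' := hg
    obtain ⟨E, hE, hEQ, k⟩ := hg'
    refine ⟨E ∪ g ⁻¹' F, hE.union (hF.preimage g.injective.injOn), ?_, ?_⟩
    · rintro x (hx | hx)
      · exact hEQ hx
      · obtain ⟨A, hA⟩ := hg.exists_eq x
        have : x = moebius A⁻¹ (g x) := by rw [hA, ← moebius_mul, inv_mul_cancel, moebius_one]
        rw [this]
        exact moebius_mem_rationalPoints _ (hFQ hx)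
    · intro J hJ hd
      rw [Set.disjoint_union_right] at hd
      obtain ⟨B, hB⟩ := k J hJ hd.1
      obtain ⟨A, hA⟩ := h (g '' J) (hJ.image _ g.continuous.continuousOn) (by
        rw [Set.disjoint_left]
        rintro _ ⟨x, hx, rfl⟩ hxF
        exact Set.disjoint_left.1 hd.2 hx hxF)
      refine ⟨A * B, fun x hx => ?_⟩
      rw [Homeomorph.mul_apply, hA _ ⟨x, hx, rfl⟩, hB x hx, moebius_mul]
  inv_mem' := by
    intro f hf
    have hf' := hf
    obtain ⟨F, hF, hFQ, h⟩ := hf'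
    refine ⟨f '' F, hF.image _, ?_, ?_⟩
    · rintro _ ⟨x, hx, rfl⟩
      obtain ⟨A, hA⟩ := hf.exists_eq x
      rw [hA]
      exact moebius_mem_rationalPoints A (hFQ hx)
    · intro J hJ hd
      obtain ⟨A, hA⟩ := h (f.symm '' J) (hJ.image _ f.symm.continuous.continuousOn) (by
        rw [Set.disjoint_left]
        rintro _ ⟨x, hx, rfl⟩ hxF
        exact Set.disjoint_left.1 hd hx ⟨_, hxF, f.apply_symm_apply x⟩)
      refine ⟨A⁻¹, fun x hx => ?_⟩
      have := hA _ ⟨x, hx, rfl⟩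
      rw [f.apply_symm_apply] at this
      rw [Homeomorph.inv_apply]
      conv_rhs => rw [this, ← moebius_mul, inv_mul_cancel, moebius_one]

/-- The Thompson group is considered as a discrete group. -/
instance : TopologicalSpace thompson := ⊥

/-- The group `PSL(2, ℤ)` as a subgroup of the Thompson group (it is contained in it, see
`modularSubgroup_le_thompson`). -/
noncomputable def thompsonPSL : Subgroup thompson := modularSubgroup.subgroupOf thompson

theorem modularSubgroup_le_thompson : modularSubgroup ≤ thompson := by
  rintro _ ⟨A, rfl⟩
  exact ⟨∅, Set.finite_empty, Set.empty_subset _, fun _ _ _ => ⟨A, fun _ _ => rfl⟩⟩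

/-! ## The Bruhat–Tits tree `T₂`, realized by the Farey triangulation -/

/-- A triangle of the Farey triangulation: (the set of vertices of) an image of the ideal triangle
`{0, 1, ∞}` under an element of `PSL(2, ℤ)`. -/
def FareyTriangle : Type :=
  {t : Set RP1 // ∃ A : SL(2, ℤ),
    t = moebius A '' {((0 : ℝ) : RP1), ((1 : ℝ) : RP1), OnePoint.infty}}

/-- The tree dual to the Farey triangulation: its vertices are the Farey triangles, two triangles
are adjacent if they have a common side. -/
def fareyTree : SimpleGraph FareyTriangle where
  Adj t t' := t ≠ t' ∧ (t.1 ∩ t'.1).ncard = 2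
  symm := ⟨fun t t' h => ⟨h.1.symm, by rw [Set.inter_comm]; exact h.2⟩⟩
  loopless := ⟨fun _ h => h.1 rfl⟩

/-- The point `ξ` of the boundary of the Farey tree lies over the point `p` of the real projective
line: the triangles of a way representing `ξ` shrink to `p`. -/
def LiesOver (ξ : Abs fareyTree) (p : RP1) : Prop :=
  ∃ a : Way fareyTree, a.toAbs = ξ ∧ ∀ N ∈ 𝓝 p, ∀ᶠ i in atTop, (a.1 i).1 ⊆ N

end Thompson

/-!
The tree. Matrix entries satisfy `a d - b c = 1`, so `(a c)(b d) = n (n + 1) ≥ 0` with `n = b c`: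
no Farey triangle has vertices strictly on both sides of `{0, ∞}`
(`subset_posArc_or_subset_negArc`). Only two triangles contain `0` and `∞`, so the side `{0, ∞}`
separates the triangles over the arc `[0, ∞]` from the others, and the dual edge is a bridge. As
`SL(2, ℤ)` is transitive on directed edges (`exists_act_eq_of_adj`) and generated by `S` and `T`,
the graph is a tree, and each branch consists of the triangles over an arc (`mem_branch_act_iff`).

The embedding. A way leaves behind every given triangle (`eventually_notMem_branch`), so for `f` in
the Thompson group it finally enters a branch whose open arc contains no break point of `f`. There
`f` coincides with some `A` in `PSL(2, ℤ)`, and `A` is unique, because it is determined by its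
values at the vertices of one triangle. The spheromorphism `thompsonToHier f` moves the ends of
this branch as `A` does. It is compatible with the map to the projective line, and it is nontrivial
for `f ≠ 1` since there are ends over all rational points.

The spherical vector. The main point is that a vector `w` fixed by `PSL(2, ℤ)` is fixed by
`Aut(T₂)` (`fixed_by_aut`). This is Mautner's argument: if `r` fixes a branch pointwise, then
`PSL(2, ℤ)` moves any finite set of triangles into this branch, so `r` has conjugates under
`PSL(2, ℤ)` that are arbitrarily close to `1`. All of them displace `w` by the same distance, hence
`r` fixes `w`. An automorphism fixing an edge is a product of two automorphisms, each fixing a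
branch at this edge pointwise, and any automorphism becomes of this kind after multiplication by an
element of `PSL(2, ℤ)`. So the `PSL(2, ℤ)`-fixed vectors are the multiples of `v`. The cyclic span
is then irreducible, because the projection of `v` to an invariant subspace is a `PSL(2, ℤ)`-fixed
vector (`eq_bot_or_eq_top_of_cyclic`).
-/

/-! ### Branches, ways and balls in trees -/

section Tree

variable {V : Type*} {T : SimpleGraph V}

theorem self_mem_branch (u w : V) : w ∈ branch T u w := SimpleGraph.Reachable.rfl

theorem mem_branch_of_adj {u w s t : V} (hs : s ∈ branch T u w) (h : T.Adj s t)
    (hne : s(s, t) ≠ s(u, w)) : t ∈ branch T u w :=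
  SimpleGraph.Reachable.trans hs
    (SimpleGraph.Adj.reachable (by rw [SimpleGraph.deleteEdges_adj]; exact ⟨h, hne⟩))

/-- A set of vertices containing `w` and closed under adjacency along the edges other than
`{u, w}` contains the branch at `w`. -/
theorem branch_subset {u w : V} {C : Set V} (hw : w ∈ C)
    (hC : ∀ s t, s ∈ C → T.Adj s t → s(s, t) ≠ s(u, w) → t ∈ C) : branch T u w ⊆ C := by
  rintro x ⟨p⟩
  have key : ∀ {s t : V} (_ : (T.deleteEdges {s(u, w)}).Walk s t), s ∈ C → t ∈ C := by
    intro s t p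
    induction p with
    | nil => exact id
    | cons h p ih =>
      rw [SimpleGraph.deleteEdges_adj] at h
      exact fun hs => ih (hC _ _ hs h.1 h.2)
  exact key p hw

theorem exists_mem_branch (hT : T.Connected) {u w : V} (t : V) :
    t ∈ branch T u w ∨ t ∈ branch T w u := by
  obtain ⟨p⟩ := hT.preconnected w t
  have key : ∀ {s t : V} (_ : T.Walk s t), s ∈ branch T u w ∨ s ∈ branch T w u →
      t ∈ branch T u w ∨ t ∈ branch T w u := by
    intro s t p
    induction p with
    | nil => exact id
    | @cons s s' t h p ih =>
      intro hs
      refine ih ?_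
      by_cases he : s(s, s') = s(u, w)
      · rcases Sym2.eq_iff.1 he with ⟨-, rfl⟩ | ⟨-, rfl⟩
        · exact Or.inl (self_mem_branch _ _)
        · exact Or.inr (self_mem_branch _ _)
      · exact hs.imp (fun hs => mem_branch_of_adj hs h he)
          fun hs => mem_branch_of_adj hs h (by rwa [Sym2.eq_swap (a := w)])
  exact key p (Or.inl (self_mem_branch _ _))

theorem notMem_branch (hT : T.IsAcyclic) {u w : V} (h : T.Adj u w) : u ∉ branch T u w := by
  intro hu
  exact SimpleGraph.isBridge_iff.1 (SimpleGraph.isAcyclic_iff_forall_adj_isBridge.1 hT h)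
    (SimpleGraph.Reachable.symm hu)

theorem branch_disjoint (hT : T.IsAcyclic) {u w t : V} (h : T.Adj u w) (ht : t ∈ branch T u w) :
    t ∉ branch T w u := by
  intro ht'
  have ht'' : (T.deleteEdges {s(u, w)}).Reachable u t := by
    rw [Sym2.eq_swap]; exact ht'
  exact notMem_branch hT h (SimpleGraph.Reachable.trans ht ht''.symm)

/-- The branch beyond an edge pointing away from `u` is contained in any branch cut off from `u`
that contains the head of this edge. -/
theorem branch_subset_branch {u w x y : V} (hy : y ∈ branch T u w) (hu : u ∉ branch T x y) :
    branch T x y ⊆ branch T u w := by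
  have : branch T x y ⊆ branch T u w ∩ branch T x y := by
    refine branch_subset ⟨hy, self_mem_branch _ _⟩ fun s t hs hst hne => ?_
    have ht := mem_branch_of_adj hs.2 hst hne
    refine ⟨mem_branch_of_adj hs.1 hst fun he => ?_, ht⟩
    rcases Sym2.eq_iff.1 he with ⟨rfl, -⟩ | ⟨-, rfl⟩
    · exact hu hs.2
    · exact hu ht
  exact this.trans Set.inter_subset_left

theorem branch_map_iff (r : T ≃g T) {u w x : V} :
    r x ∈ branch T (r u) (r w) ↔ x ∈ branch T u w := by
  refine ⟨fun h => ?_, branch_map r⟩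
  simpa using branch_map r⁻¹ h

theorem branch_way_subset (hT : T.IsAcyclic) (a : Way T) {m n : ℕ} (h : m ≤ n) :
    branch T (a.1 n) (a.1 (n + 1)) ⊆ branch T (a.1 m) (a.1 (m + 1)) := by
  induction n, h using Nat.le_induction with
  | base => exact subset_rfl
  | succ n _ ih =>
    refine Set.Subset.trans (branch_subset_branch ?_ ?_) ih
    · refine mem_branch_of_adj (self_mem_branch _ _) (a.2.1 (n + 1)) fun he => ?_
      rcases Sym2.eq_iff.1 he with ⟨h, -⟩ | ⟨-, h⟩
      · exact (a.2.1 n).ne h.symm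
      · exact a.2.2 n h
    · intro hu
      refine notMem_branch hT (a.2.1 (n + 1)) (mem_branch_of_adj hu (a.2.1 n) fun he => ?_)
      rcases Sym2.eq_iff.1 he with ⟨h, -⟩ | ⟨h, -⟩
      · exact (a.2.1 n).ne h
      · exact a.2.2 n h.symm

/-- A way leaves every vertex behind. Otherwise a walk from the way to this vertex would run along
the whole way. -/
theorem eventually_notMem_branch (hT : T.IsTree) (a : Way T) (u : V) :
    ∀ᶠ n in atTop, u ∉ branch T (a.1 n) (a.1 (n + 1)) := by
  classical
  rw [eventually_atTop]
  by_contra! hcon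
  have hall : ∀ n, u ∈ branch T (a.1 n) (a.1 (n + 1)) := fun n => by
    obtain ⟨m, hm, hu⟩ := hcon n
    exact branch_way_subset hT.isAcyclic a hm hu
  have key : ∀ L n (p : T.Walk (a.1 n) u), p.length ≤ L → False := by
    intro L
    induction L with
    | zero =>
      intro n p hp
      have := SimpleGraph.Walk.eq_of_length_eq_zero (Nat.le_zero.1 hp)
      exact notMem_branch hT.isAcyclic (a.2.1 n) (this ▸ hall n)
    | succ L ih =>
      intro n p hp
      have he : s(a.1 n, a.1 (n + 1)) ∈ p.edges := by
        refine p.mem_edges_of_not_reachable_deleteEdges fun h => ?_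
        exact notMem_branch hT.isAcyclic (a.2.1 n) (SimpleGraph.Reachable.trans (hall n) h.symm)
      have hs : a.1 (n + 1) ∈ p.support := p.snd_mem_support_of_mem_edges he
      have hlen := congrArg SimpleGraph.Walk.length (p.take_spec hs)
      rw [SimpleGraph.Walk.length_append] at hlen
      have hpos : (p.takeUntil _ hs).length ≠ 0 := fun h =>
        (a.2.1 n).ne (SimpleGraph.Walk.eq_of_length_eq_zero h)
      exact ih (n + 1) (p.dropUntil _ hs) (by omega)
  obtain ⟨p⟩ := hT.connected.preconnected (a.1 0) u
  exact key _ 0 p le_rfl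

/-- The branches along a way form a basis of the balls containing the end of the way. -/
theorem eventually_branch_subset (hT : T.IsTree) (a : Way T) {u w : V}
    (h : a.toAbs ∈ ball T u w) :
    ∀ᶠ n in atTop, branch T (a.1 n) (a.1 (n + 1)) ⊆ branch T u w := by
  obtain ⟨b, hb, hbw⟩ := h
  obtain ⟨m, n, hmn⟩ := Quotient.exact hb
  filter_upwards [eventually_notMem_branch hT a u, eventually_ge_atTop n] with k hk hkn
  refine branch_subset_branch ?_ hk
  obtain ⟨j, hj⟩ : ∃ j, k + 1 = n + j := ⟨k + 1 - n, by omega⟩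
  rw [hj, ← hmn j]
  exact hbw _

theorem toAbs_mem_ball (hT : T.IsAcyclic) (a : Way T) (n : ℕ) :
    a.toAbs ∈ ball T (a.1 n) (a.1 (n + 1)) := by
  refine ⟨⟨fun i => a.1 (n + 1 + i), fun i => a.2.1 _, fun i => a.2.2 _⟩, ?_, fun i => ?_⟩
  · exact Quotient.sound ⟨0, n + 1, fun i => by simp⟩
  · have := branch_way_subset hT a (Nat.le_add_right n i) (self_mem_branch _ _)
    rwa [show n + i + 1 = n + 1 + i by omega] at this

theorem isOpen_ball {u w : V} (h : T.Adj u w) : IsOpen (ball T u w) :=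
  TopologicalSpace.isOpen_generateFrom_of_mem ⟨u, w, h, rfl⟩

theorem nonempty_branch_inter_branch {u w u' w' : V} {ξ : Abs T} (h : ξ ∈ ball T u w)
    (h' : ξ ∈ ball T u' w') : (branch T u w ∩ branch T u' w').Nonempty := by
  obtain ⟨a, rfl, ha⟩ := h
  obtain ⟨b, hb, hbw⟩ := h'
  obtain ⟨m, n, hmn⟩ := Quotient.exact hb
  refine ⟨a.1 n, ha n, ?_⟩
  have := hmn 0
  rw [add_zero, add_zero] at this
  rw [← this]
  exact hbw m

theorem exists_ball_subset_inter (hT : T.IsTree) {u w u' w' : V} {ξ : Abs T}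
    (h : ξ ∈ ball T u w) (h' : ξ ∈ ball T u' w') :
    ∃ x y, T.Adj x y ∧ ξ ∈ ball T x y ∧ branch T x y ⊆ branch T u w ∩ branch T u' w' := by
  obtain ⟨a, rfl⟩ := Quotient.exists_rep ξ
  obtain ⟨n, h1, h2⟩ :=
    ((eventually_branch_subset hT a h).and (eventually_branch_subset hT a h')).exists
  exact ⟨a.1 n, a.1 (n + 1), a.2.1 n, toAbs_mem_ball hT.isAcyclic a n, Set.subset_inter h1 h2⟩

theorem exists_mem_ball (hT : T.IsTree) (ξ : Abs T) : ∃ u w, T.Adj u w ∧ ξ ∈ ball T u w := by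
  obtain ⟨a, rfl⟩ := Quotient.exists_rep ξ
  exact ⟨_, _, a.2.1 0, toAbs_mem_ball hT.isAcyclic a 0⟩

theorem adj_eq_of_mem_of_notMem {u w s t : V} (hs : s ∈ branch T u w) (ht : t ∉ branch T u w)
    (h : T.Adj s t) (hT : T.IsAcyclic) (huw : T.Adj u w) : s = w ∧ t = u := by
  by_contra hcon
  refine ht (mem_branch_of_adj hs h fun he => ?_)
  rcases Sym2.eq_iff.1 he with ⟨rfl, -⟩ | h
  · exact notMem_branch hT huw hs
  · exact hcon h

open Classical in
/-- The map that coincides with `r` on a branch and with the identity outside of it. -/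
noncomputable def spliceFun (r : T ≃g T) (u w : V) (x : V) : V :=
  if x ∈ branch T u w then r x else x

theorem spliceFun_adj (hT : T.IsAcyclic) {u w : V} (huw : T.Adj u w) (r : T ≃g T) (hu : r u = u)
    (hw : r w = w) {x y : V} (h : T.Adj x y) :
    T.Adj (spliceFun r u w x) (spliceFun r u w y) := by
  unfold spliceFun
  split_ifs with hx hy hy
  · exact r.map_adj_iff.2 h
  · obtain ⟨rfl, rfl⟩ := adj_eq_of_mem_of_notMem hx hy h hT huw
    rwa [hw]
  · obtain ⟨rfl, rfl⟩ := adj_eq_of_mem_of_notMem hy hx h.symm hT huw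
    rwa [hw]
  · exact h

theorem spliceFun_inv {u w : V} (r : T ≃g T) (hu : r u = u)
    (hw : r w = w) (x : V) : spliceFun r⁻¹ u w (spliceFun r u w x) = x := by
  by_cases hx : x ∈ branch T u w
  · have : r x ∈ branch T u w := by
      have := branch_map r hx
      rwa [hu, hw] at this
    simp [spliceFun, hx, this]
  · simp [spliceFun, hx]

/-- An automorphism fixing an edge, cut off outside one of the two branches at this edge. -/
noncomputable def splice (hT : T.IsAcyclic) {u w : V} (huw : T.Adj u w) (r : T ≃g T)
    (hu : r u = u) (hw : r w = w) : T ≃g T :=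
  have hu' : r⁻¹ u = u := by nth_rw 1 [← hu]; simp
  have hw' : r⁻¹ w = w := by nth_rw 1 [← hw]; simp
  { toFun := spliceFun r u w
    invFun := spliceFun r⁻¹ u w
    left_inv := spliceFun_inv r hu hw
    right_inv := fun x => by simpa using spliceFun_inv r⁻¹ hu' hw' x
    map_rel_iff' := by
      intro x y
      refine ⟨fun h => ?_, spliceFun_adj hT huw r hu hw⟩
      have := spliceFun_adj hT huw r⁻¹ hu' hw' h
      simpa only [Equiv.coe_fn_mk, spliceFun_inv r hu hw] using this }

/-- An automorphism fixing an edge is a product of two automorphisms, each fixing pointwise one of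
the two branches at this edge. -/
theorem exists_mul_eq_of_fixes_edge (hT : T.IsAcyclic) {u w : V} (huw : T.Adj u w) (r : T ≃g T)
    (hu : r u = u) (hw : r w = w) : ∃ r₁ r₂ : T ≃g T, r = r₁ * r₂ ∧
      (∀ x ∈ branch T w u, r₁ x = x) ∧ ∀ x ∈ branch T u w, r₂ x = x := by
  refine ⟨splice hT huw r hu hw, (splice hT huw r hu hw)⁻¹ * r, by simp, fun x hx => ?_,
    fun x hx => ?_⟩
  · exact if_neg (branch_disjoint hT huw.symm hx)
  · have : splice hT huw r hu hw x = r x := if_pos hx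
    rw [RelIso.mul_apply, ← this, RelIso.inv_apply_self]

end Tree

/-! ### Farey triangles -/

section Farey

/-- The reference triangle `{0, 1, ∞}`. -/
def baseSet : Set RP1 := {((0 : ℝ) : RP1), ((1 : ℝ) : RP1), OnePoint.infty}

/-- The Farey triangle with vertices `A 0`, `A 1`, `A ∞`. -/
noncomputable def tri (A : SL(2, ℤ)) : FareyTriangle := ⟨moebius A '' baseSet, A, rfl⟩

theorem exists_tri (t : FareyTriangle) : ∃ A, t = tri A := by
  obtain ⟨t, A, rfl⟩ := t
  exact ⟨A, rfl⟩

theorem moebius_inv_moebius (A : SL(2, ℤ)) (x : RP1) : moebius A⁻¹ (moebius A x) = x := by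
  rw [← moebius_mul, inv_mul_cancel, moebius_one]

theorem moebius_moebius_inv (A : SL(2, ℤ)) (x : RP1) : moebius A (moebius A⁻¹ x) = x := by
  rw [← moebius_mul, mul_inv_cancel, moebius_one]

theorem moebius_injective (A : SL(2, ℤ)) : Function.Injective (moebius A) :=
  Function.LeftInverse.injective (moebius_inv_moebius A)

theorem mem_moebius_image (A : SL(2, ℤ)) (s : Set RP1) (x : RP1) :
    x ∈ moebius A '' s ↔ moebius A⁻¹ x ∈ s := by
  constructor
  · rintro ⟨y, hy, rfl⟩
    rwa [moebius_inv_moebius]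
  · exact fun h => ⟨_, h, moebius_moebius_inv A x⟩

/-- The image of a Farey triangle under a fractional linear transformation. -/
noncomputable def act (A : SL(2, ℤ)) (t : FareyTriangle) : FareyTriangle :=
  ⟨moebius A '' t.1, by
    obtain ⟨t, B, rfl⟩ := t
    refine ⟨A * B, ?_⟩
    rw [Set.image_image]
    exact Set.image_congr fun x _ => (moebius_mul A B x).symm⟩

theorem act_tri (A B : SL(2, ℤ)) : act A (tri B) = tri (A * B) := by
  refine Subtype.ext ?_
  change moebius A '' (moebius B '' baseSet) = moebius (A * B) '' baseSet
  rw [Set.image_image]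
  exact Set.image_congr fun x _ => (moebius_mul A B x).symm

theorem act_tri_one (A : SL(2, ℤ)) : act A (tri 1) = tri A := by rw [act_tri, mul_one]

theorem act_mul (A B : SL(2, ℤ)) (t : FareyTriangle) : act (A * B) t = act A (act B t) := by
  obtain ⟨C, rfl⟩ := exists_tri t
  rw [act_tri, act_tri, act_tri, mul_assoc]

theorem act_one (t : FareyTriangle) : act 1 t = t := by
  obtain ⟨C, rfl⟩ := exists_tri t
  rw [act_tri, one_mul]

theorem act_inv_act (A : SL(2, ℤ)) (t : FareyTriangle) : act A⁻¹ (act A t) = t := by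
  rw [← act_mul, inv_mul_cancel, act_one]

theorem act_act_inv (A : SL(2, ℤ)) (t : FareyTriangle) : act A (act A⁻¹ t) = t := by
  rw [← act_mul, mul_inv_cancel, act_one]

theorem act_adj (A : SL(2, ℤ)) {s t : FareyTriangle} :
    fareyTree.Adj (act A s) (act A t) ↔ fareyTree.Adj s t := by
  change (_ ≠ _ ∧ (moebius A '' s.1 ∩ moebius A '' t.1).ncard = 2) ↔ _
  rw [← Set.image_inter (moebius_injective A), Set.ncard_image_of_injective _ (moebius_injective A),
    (Function.LeftInverse.injective (act_inv_act A)).ne_iff]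
  rfl

/-- The action of `SL(2, ℤ)` on the Farey tree. -/
noncomputable def fareyAut : SL(2, ℤ) →* (fareyTree ≃g fareyTree) where
  toFun A :=
    { toFun := act A
      invFun := act A⁻¹
      left_inv := act_inv_act A
      right_inv := act_act_inv A
      map_rel_iff' := act_adj A }
  map_one' := RelIso.ext act_one
  map_mul' A B := RelIso.ext (act_mul A B)

@[simp] theorem fareyAut_apply (A : SL(2, ℤ)) (t : FareyTriangle) : fareyAut A t = act A t := rfl

/-- The transformation `x ↦ x / (x + 1)`. -/
def lowerU : SL(2, ℤ) := ⟨!![1, 0; 1, 1], by simp⟩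

theorem moebius_lowerU_coe (x : ℝ) : moebius lowerU (x : RP1) =
    if x + 1 = 0 then OnePoint.infty else ((x / (x + 1) : ℝ) : RP1) := by
  rw [moebius_coe]; simp [lowerU]

theorem moebius_lowerU_infty : moebius lowerU OnePoint.infty = ((1 : ℝ) : RP1) := by
  rw [moebius_infty]; simp [lowerU]

theorem moebius_S_S (x : RP1) : moebius ModularGroup.S (moebius ModularGroup.S x) = x := by
  induction x using OnePoint.rec with
  | infty => simp [moebius_S_infty, moebius_S_coe]
  | coe x =>
    by_cases hx : x = 0
    · simp [hx, moebius_S_infty, moebius_S_coe]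
    · simp [hx, moebius_S_coe]

theorem act_S_S (t : FareyTriangle) : act ModularGroup.S (act ModularGroup.S t) = t := by
  refine Subtype.ext ?_
  change moebius _ '' (moebius _ '' t.1) = t.1
  rw [Set.image_image]
  simp [moebius_S_S]

theorem act_val (A : SL(2, ℤ)) (t : FareyTriangle) : (act A t).1 = moebius A '' t.1 := rfl

theorem tri_one_val : (tri 1).1 = baseSet := by
  change moebius 1 '' baseSet = _
  rw [funext moebius_one, Set.image_id']

theorem tri_S_val : (tri ModularGroup.S).1 =
    {OnePoint.infty, ((-1 : ℝ) : RP1), ((0 : ℝ) : RP1)} := by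
  simp [tri, baseSet, Set.image_insert_eq, moebius_S_coe, moebius_S_infty]

theorem tri_T_val : (tri ModularGroup.T).1 =
    {((1 : ℝ) : RP1), ((2 : ℝ) : RP1), OnePoint.infty} := by
  simp only [tri, baseSet, Set.image_insert_eq, Set.image_singleton, moebius_T_coe,
    moebius_T_infty]
  norm_num

theorem tri_lowerU_val : (tri lowerU).1 =
    {((0 : ℝ) : RP1), ((1 / 2 : ℝ) : RP1), ((1 : ℝ) : RP1)} := by
  simp only [tri, baseSet, Set.image_insert_eq, Set.image_singleton, moebius_lowerU_coe,
    moebius_lowerU_infty]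
  norm_num

theorem act_T_tri_S : act ModularGroup.T (tri ModularGroup.S) = tri 1 := by
  refine Subtype.ext ?_
  rw [tri_one_val, act_val, tri_S_val]
  simp only [baseSet, Set.image_insert_eq, Set.image_singleton, moebius_T_coe,
    moebius_T_infty]
  norm_num
  ext x
  simp only [Set.mem_insert_iff, Set.mem_singleton_iff]
  tauto

theorem act_lowerU_tri_S : act lowerU (tri ModularGroup.S) = tri 1 := by
  refine Subtype.ext ?_
  rw [tri_one_val, act_val, tri_S_val]
  simp only [baseSet, Set.image_insert_eq, Set.image_singleton, moebius_lowerU_coe,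
    moebius_lowerU_infty]
  norm_num
  ext x
  simp only [Set.mem_insert_iff, Set.mem_singleton_iff]
  tauto

theorem det_entries (A : SL(2, ℤ)) : A 0 0 * A 1 1 - A 0 1 * A 1 0 = 1 := by
  have := A.det_coe
  rwa [Matrix.det_fin_two] at this

/-- The point `a / c` of the projective line, equal to `∞` if `c = 0`. -/
noncomputable def frac (a c : ℤ) : RP1 :=
  if c = 0 then OnePoint.infty else (((a : ℝ) / c : ℝ) : RP1)

theorem moebius_infty_eq_frac (A : SL(2, ℤ)) :
    moebius A OnePoint.infty = frac (A 0 0) (A 1 0) := by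
  rw [moebius_infty, frac]; simp

theorem moebius_zero_eq_frac (A : SL(2, ℤ)) :
    moebius A ((0 : ℝ) : RP1) = frac (A 0 1) (A 1 1) := by
  rw [moebius_coe, frac]; simp

theorem moebius_one_eq_frac (A : SL(2, ℤ)) :
    moebius A ((1 : ℝ) : RP1) = frac (A 0 0 + A 0 1) (A 1 0 + A 1 1) := by
  rw [moebius_coe, frac]
  have : ((A 1 0 : ℝ) * 1 + A 1 1 = 0) ↔ A 1 0 + A 1 1 = 0 := by
    rw [mul_one]; norm_cast
  simp only [this]
  push_cast
  simp

theorem tri_val (A : SL(2, ℤ)) : (tri A).1 =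
    {frac (A 0 1) (A 1 1), frac (A 0 0 + A 0 1) (A 1 0 + A 1 1), frac (A 0 0) (A 1 0)} := by
  simp only [tri, baseSet, Set.image_insert_eq, Set.image_singleton, moebius_infty_eq_frac,
    moebius_zero_eq_frac, moebius_one_eq_frac]

theorem frac_eq_infty {a c : ℤ} : frac a c = OnePoint.infty ↔ c = 0 := by
  unfold frac; split_ifs with h <;> simp [h]

theorem frac_eq_zero {a c : ℤ} : frac a c = ((0 : ℝ) : RP1) ↔ a = 0 ∧ c ≠ 0 := by
  unfold frac; split_ifs with h
  · simp [h]
  · rw [OnePoint.coe_eq_coe]; simp [h]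

theorem frac_unit {a c : ℤ} (h : a * c = 1 ∨ a * c = -1) :
    frac a c = ((1 : ℝ) : RP1) ∨ frac a c = ((-1 : ℝ) : RP1) := by
  rcases h with h | h
  · rcases Int.mul_eq_one_iff_eq_one_or_neg_one.1 h with ⟨rfl, rfl⟩ | ⟨rfl, rfl⟩ <;>
      simp [frac]
  · rcases Int.mul_eq_neg_one_iff_eq_one_or_neg_one.1 h with ⟨rfl, rfl⟩ | ⟨rfl, rfl⟩ <;>
      simp [frac]

/-- Only two Farey triangles have the side with endpoints `0` and `∞`. -/
theorem eq_or_eq_of_zero_mem_of_infty_mem {t : FareyTriangle} (h0 : ((0 : ℝ) : RP1) ∈ t.1)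
    (h1 : OnePoint.infty ∈ t.1) : t = tri 1 ∨ t = tri ModularGroup.S := by
  obtain ⟨A, rfl⟩ := exists_tri t
  have hdet := det_entries A
  suffices h : (tri A).1 = baseSet ∨
      (tri A).1 = {OnePoint.infty, ((-1 : ℝ) : RP1), ((0 : ℝ) : RP1)} from
    h.imp (fun h => Subtype.ext (h.trans tri_one_val.symm))
      fun h => Subtype.ext (h.trans tri_S_val.symm)
  rw [tri_val] at h0 h1 ⊢
  generalize A 0 0 = a at *
  generalize A 0 1 = b at *
  generalize A 1 0 = c at *
  generalize A 1 1 = d at *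
  simp only [Set.mem_insert_iff, Set.mem_singleton_iff, eq_comm (a := ((0 : ℝ) : RP1)),
    eq_comm (a := (OnePoint.infty : RP1))] at h0 h1
  -- The third vertex is `1` or `-1`.
  have key : ∀ {x y z : RP1}, (x = ((0 : ℝ) : RP1) ∧ y = OnePoint.infty) →
      (z = ((1 : ℝ) : RP1) ∨ z = ((-1 : ℝ) : RP1)) → ∀ s : Set RP1, s = {x, y, z} →
      s = baseSet ∨ s = {OnePoint.infty, ((-1 : ℝ) : RP1), ((0 : ℝ) : RP1)} := by
    rintro x y z ⟨rfl, rfl⟩ (rfl | rfl) s rfl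
    · left; ext; simp only [baseSet, Set.mem_insert_iff, Set.mem_singleton_iff]; tauto
    · right; ext; simp only [Set.mem_insert_iff, Set.mem_singleton_iff]; tauto
  have hperm : ∀ x y z : RP1, ({x, y, z} : Set RP1) = {x, z, y} ∧ ({x, y, z} : Set RP1) = {y, x, z}
      ∧ ({x, y, z} : Set RP1) = {y, z, x} ∧ ({x, y, z} : Set RP1) = {z, x, y}
      ∧ ({x, y, z} : Set RP1) = {z, y, x} := by
    intro x y z
    refine ⟨?_, ?_, ?_, ?_, ?_⟩ <;>
      (ext; simp only [Set.mem_insert_iff, Set.mem_singleton_iff]; tauto)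
  obtain ⟨p1, p2, p3, p4, p5⟩ := hperm (frac b d) (frac (a + b) (c + d)) (frac a c)
  rcases h0 with h0 | h0 | h0 <;> rcases h1 with h1 | h1 | h1
  · rw [h0] at h1; exact absurd h1 (OnePoint.coe_ne_infty _)
  · refine key ⟨h0, h1⟩ (frac_unit ?_) _ rfl
    rw [frac_eq_zero] at h0; rw [frac_eq_infty] at h1; right; clear * - hdet h0 h1; grind
  · refine key ⟨h0, h1⟩ (frac_unit ?_) _ p1
    rw [frac_eq_zero] at h0; rw [frac_eq_infty] at h1; left; clear * - hdet h0 h1; grind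
  · refine key ⟨h0, h1⟩ (frac_unit ?_) _ p2
    rw [frac_eq_zero] at h0; rw [frac_eq_infty] at h1; left; clear * - hdet h0 h1; grind
  · rw [h0] at h1; exact absurd h1 (OnePoint.coe_ne_infty _)
  · refine key ⟨h0, h1⟩ (frac_unit ?_) _ p3
    rw [frac_eq_zero] at h0; rw [frac_eq_infty] at h1; right; clear * - hdet h0 h1; grind
  · refine key ⟨h0, h1⟩ (frac_unit ?_) _ p4
    rw [frac_eq_zero] at h0; rw [frac_eq_infty] at h1; right; clear * - hdet h0 h1; grind
  · refine key ⟨h0, h1⟩ (frac_unit ?_) _ p5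
    rw [frac_eq_zero] at h0; rw [frac_eq_infty] at h1; left; clear * - hdet h0 h1; grind
  · rw [h0] at h1; exact absurd h1 (OnePoint.coe_ne_infty _)

end Farey

/-! ### The Farey tree -/

section FareyTree

theorem mem_act_inv (A : SL(2, ℤ)) (t : FareyTriangle) (x : RP1) :
    x ∈ (act A⁻¹ t).1 ↔ moebius A x ∈ t.1 := by
  rw [act_val, mem_moebius_image, inv_inv]

theorem adj_tri_one_S : fareyTree.Adj (tri 1) (tri ModularGroup.S) := by
  have hinter : (tri 1).1 ∩ (tri ModularGroup.S).1 = {((0 : ℝ) : RP1), OnePoint.infty} := by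
    rw [tri_one_val, tri_S_val, baseSet]
    ext x
    simp only [Set.mem_inter_iff, Set.mem_insert_iff, Set.mem_singleton_iff]
    constructor
    · rintro ⟨rfl | rfl | rfl, h⟩
      · exact Or.inl rfl
      · norm_num [OnePoint.coe_eq_coe] at h
      · exact Or.inr rfl
    · rintro (rfl | rfl) <;> simp
  refine ⟨fun h => ?_, ?_⟩
  · have h1 : ((1 : ℝ) : RP1) ∈ (tri ModularGroup.S).1 := by
      rw [← h, tri_one_val]; simp [baseSet]
    rw [tri_S_val] at h1
    norm_num [OnePoint.coe_eq_coe] at h1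
  · rw [hinter]
    exact Set.ncard_pair (OnePoint.coe_ne_infty _)

theorem adj_tri_S_one : fareyTree.Adj (tri ModularGroup.S) (tri 1) := adj_tri_one_S.symm

theorem adj_tri_one_T : fareyTree.Adj (tri 1) (tri ModularGroup.T) := by
  have := (act_adj ModularGroup.T).2 adj_tri_S_one
  rwa [act_T_tri_S, act_tri_one] at this

theorem adj_tri_one_lowerU : fareyTree.Adj (tri 1) (tri lowerU) := by
  have := (act_adj lowerU).2 adj_tri_S_one
  rwa [act_lowerU_tri_S, act_tri_one] at this

theorem adj_tri_one_iff (t : FareyTriangle) : fareyTree.Adj (tri 1) t ↔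
    t = tri ModularGroup.S ∨ t = tri ModularGroup.T ∨ t = tri lowerU := by
  constructor
  · rintro ⟨hne, hcard⟩
    obtain ⟨x, y, hxy, hinter⟩ := Set.ncard_eq_two.1 hcard
    have hx : x ∈ (tri 1).1 ∩ t.1 := by rw [hinter]; simp
    have hy : y ∈ (tri 1).1 ∩ t.1 := by rw [hinter]; simp
    rw [tri_one_val] at hx hy
    have h : (((0 : ℝ) : RP1) ∈ t.1 ∧ OnePoint.infty ∈ t.1) ∨
        (((1 : ℝ) : RP1) ∈ t.1 ∧ OnePoint.infty ∈ t.1) ∨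
        (((0 : ℝ) : RP1) ∈ t.1 ∧ ((1 : ℝ) : RP1) ∈ t.1) := by
      obtain ⟨hx, hx'⟩ := hx
      obtain ⟨hy, hy'⟩ := hy
      simp only [baseSet, Set.mem_insert_iff, Set.mem_singleton_iff] at hx hy
      rcases hx with rfl | rfl | rfl <;> rcases hy with rfl | rfl | rfl <;> tauto
    -- The sides `{1, ∞}` and `{0, 1}` are the images of `{0, ∞}` under `T` and `lowerU`.
    have key : ∀ A : SL(2, ℤ), act A (tri ModularGroup.S) = tri 1 →
        moebius A ((0 : ℝ) : RP1) ∈ t.1 → moebius A OnePoint.infty ∈ t.1 → t = tri A := by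
      intro A hA h0 h1
      rcases eq_or_eq_of_zero_mem_of_infty_mem ((mem_act_inv A t _).2 h0)
        ((mem_act_inv A t _).2 h1) with h | h
      · rw [← act_act_inv A t, h, act_tri_one]
      · exact absurd (by rw [← act_act_inv A t, h, hA]) hne
    rcases h with ⟨h0, h1⟩ | ⟨h0, h1⟩ | ⟨h0, h1⟩
    · exact Or.inl ((eq_or_eq_of_zero_mem_of_infty_mem h0 h1).resolve_left hne.symm)
    · refine Or.inr (Or.inl (key _ act_T_tri_S ?_ ?_))
      · rwa [moebius_T_coe, zero_add]
      · rwa [moebius_T_infty]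
    · refine Or.inr (Or.inr (key _ act_lowerU_tri_S ?_ ?_))
      · simpa [moebius_lowerU_coe] using h0
      · rwa [moebius_lowerU_infty]
  · rintro (rfl | rfl | rfl)
    exacts [adj_tri_one_S, adj_tri_one_T, adj_tri_one_lowerU]

/-- The group `SL(2, ℤ)` acts transitively on the directed edges of the Farey tree. -/
theorem exists_act_eq_of_adj {s t : FareyTriangle} (h : fareyTree.Adj s t) :
    ∃ A, s = act A (tri ModularGroup.S) ∧ t = act A (tri 1) := by
  obtain ⟨B, rfl⟩ := exists_tri t
  rw [← act_adj B⁻¹, act_tri, inv_mul_cancel, SimpleGraph.adj_comm, adj_tri_one_iff] at h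
  have key : ∀ A, act A (tri ModularGroup.S) = tri 1 → act B⁻¹ s = tri A →
      ∃ A, s = act A (tri ModularGroup.S) ∧ tri B = act A (tri 1) := by
    intro A hA hs
    refine ⟨B * (A * ModularGroup.S), ?_, ?_⟩
    · rw [act_mul, act_mul, ← act_tri_one ModularGroup.S, act_S_S, act_tri_one, ← hs, act_act_inv]
    · rw [act_mul, act_mul, act_tri_one, hA, act_tri_one]
  rcases h with h | h | h
  · exact ⟨B, by rw [← h, act_act_inv], (act_tri_one B).symm⟩
  · exact key _ act_T_tri_S h
  · exact key _ act_lowerU_tri_S h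

theorem reachable_tri_one (A : SL(2, ℤ)) : fareyTree.Reachable (tri 1) (tri A) := by
  have hact : ∀ (B : SL(2, ℤ)) {s t : FareyTriangle}, fareyTree.Reachable s t →
      fareyTree.Reachable (act B s) (act B t) := fun B _ _ h =>
    SimpleGraph.Reachable.map (fareyAut B).toRelEmbedding.toRelHom h
  have hA : A ∈ Subgroup.closure {ModularGroup.S, ModularGroup.T} := by
    rw [SpecialLinearGroup.SL2Z_generators]; trivial
  induction hA using Subgroup.closure_induction with
  | mem A hA =>
    rcases hA with rfl | rfl
    · exact adj_tri_one_S.reachable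
    · exact adj_tri_one_T.reachable
  | one => exact SimpleGraph.Reachable.rfl
  | mul A B _ _ hA hB =>
    refine hA.trans ?_
    have := hact A hB
    rwa [act_tri_one, act_tri] at this
  | inv A _ hA =>
    have := hact A⁻¹ hA
    rw [act_tri_one, act_tri, inv_mul_cancel] at this
    exact this.symm

theorem fareyTree_connected : fareyTree.Connected := by
  rw [SimpleGraph.connected_iff_exists_forall_reachable]
  refine ⟨tri 1, fun t => ?_⟩
  obtain ⟨A, rfl⟩ := exists_tri t
  exact reachable_tri_one A

/-- The closed arc of the projective line from `0` to `∞` through the positive numbers. -/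
def posArc : Set RP1 := {x | ∀ r : ℝ, x = (r : RP1) → 0 ≤ r}

/-- The closed arc of the projective line from `∞` to `0` through the negative numbers. -/
def negArc : Set RP1 := {x | ∀ r : ℝ, x = (r : RP1) → r ≤ 0}

theorem coe_mem_posArc {r : ℝ} : (r : RP1) ∈ posArc ↔ 0 ≤ r := by
  simp [posArc]

theorem coe_mem_negArc {r : ℝ} : (r : RP1) ∈ negArc ↔ r ≤ 0 := by
  simp [negArc]

theorem infty_mem_posArc : OnePoint.infty ∈ posArc := fun _ h =>
  absurd h (OnePoint.infty_ne_coe _)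

theorem infty_mem_negArc : OnePoint.infty ∈ negArc := fun _ h =>
  absurd h (OnePoint.infty_ne_coe _)

theorem frac_mem_posArc {a c : ℤ} : frac a c ∈ posArc ↔ 0 ≤ a * c := by
  unfold frac
  split_ifs with h
  · simp [h, infty_mem_posArc]
  · have h' : (c : ℝ) ≠ 0 := by exact_mod_cast h
    rw [coe_mem_posArc, show (a : ℝ) / c = (a * c : ℤ) / (c : ℝ) ^ 2 by push_cast; field_simp,
      le_div_iff₀ (by positivity), zero_mul]
    norm_cast

theorem frac_mem_negArc {a c : ℤ} : frac a c ∈ negArc ↔ a * c ≤ 0 := by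
  unfold frac
  split_ifs with h
  · simp [h, infty_mem_negArc]
  · have h' : (c : ℝ) ≠ 0 := by exact_mod_cast h
    rw [coe_mem_negArc, show (a : ℝ) / c = (a * c : ℤ) / (c : ℝ) ^ 2 by push_cast; field_simp,
      div_le_iff₀ (by positivity), zero_mul]
    norm_cast

/-- The endpoints of a Farey side do not lie strictly on both sides of `{0, ∞}`: with
`n = b * c` the product of `a * c` and `b * d` is `n * (n + 1) ≥ 0`. -/
theorem mul_nonneg_of_det_eq_one {a b c d : ℤ} (h : a * d - b * c = 1) :
    0 ≤ (a * c) * (b * d) := by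
  have h1 : (a * c) * (b * d) = (b * c) * (b * c + 1) := by
    rw [show b * c + 1 = a * d by omega]; ring
  rw [h1]
  rcases le_or_gt 0 (b * c) with h2 | h2
  · positivity
  · exact mul_nonneg_of_nonpos_of_nonpos h2.le (by omega)

/-- The sides of the Farey triangles do not cross the side `{0, ∞}`. -/
theorem subset_posArc_or_subset_negArc (t : FareyTriangle) : t.1 ⊆ posArc ∨ t.1 ⊆ negArc := by
  obtain ⟨A, rfl⟩ := exists_tri t
  have hdet := det_entries A
  rw [tri_val]
  simp only [Set.insert_subset_iff, Set.singleton_subset_iff, frac_mem_posArc, frac_mem_negArc]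
  generalize A 0 0 = a at *
  generalize A 0 1 = b at *
  generalize A 1 0 = c at *
  generalize A 1 1 = d at *
  have h1 := mul_nonneg_of_det_eq_one hdet
  have h2 := mul_nonneg_of_det_eq_one (a := a) (b := a + b) (c := c) (d := c + d) (by linarith)
  have h3 := mul_nonneg_of_det_eq_one (a := a + b) (b := b) (c := c + d) (d := d) (by linarith)
  rw [mul_nonneg_iff] at h1 h2 h3
  omega

theorem eq_of_mem_posArc_of_mem_negArc {x : RP1} (h : x ∈ posArc) (h' : x ∈ negArc) :
    x = ((0 : ℝ) : RP1) ∨ x = OnePoint.infty := by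
  induction x using OnePoint.rec with
  | infty => exact Or.inr rfl
  | coe x =>
    rw [coe_mem_posArc] at h
    rw [coe_mem_negArc] at h'
    exact Or.inl (by rw [le_antisymm h' h])

theorem tri_one_subset : (tri 1).1 ⊆ posArc := by
  rw [tri_one_val]
  simp [baseSet, Set.insert_subset_iff, coe_mem_posArc, infty_mem_posArc]

theorem not_tri_S_subset : ¬ (tri ModularGroup.S).1 ⊆ posArc := by
  rw [tri_S_val]
  simp [Set.insert_subset_iff, coe_mem_posArc]

theorem not_subset_negArc_of_subset_posArc {t : FareyTriangle} (h : t.1 ⊆ posArc) :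
    ¬ t.1 ⊆ negArc := by
  intro h'
  have h3 : t.1.ncard = 3 := by
    obtain ⟨A, rfl⟩ := exists_tri t
    rw [tri, Set.ncard_image_of_injective _ (moebius_injective A), baseSet, Set.ncard_eq_three]
    exact ⟨_, _, _, by simp, by simp, by simp, rfl⟩
  have hsub : t.1 ⊆ {((0 : ℝ) : RP1), OnePoint.infty} := fun x hx =>
    eq_of_mem_posArc_of_mem_negArc (h hx) (h' hx)
  have := Set.ncard_le_ncard hsub (by simp)
  rw [Set.ncard_pair (OnePoint.coe_ne_infty _)] at this
  omega

theorem branch_subset_posArc :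
    branch fareyTree (tri ModularGroup.S) (tri 1) ⊆ {t | t.1 ⊆ posArc} := by
  refine branch_subset tri_one_subset fun s t hs hst hne => ?_
  by_contra ht
  have hneg := (subset_posArc_or_subset_negArc t).resolve_left ht
  refine hne ?_
  have hsub : s.1 ∩ t.1 ⊆ {((0 : ℝ) : RP1), OnePoint.infty} := fun x hx =>
    eq_of_mem_posArc_of_mem_negArc (hs hx.1) (hneg hx.2)
  have heq : s.1 ∩ t.1 = {((0 : ℝ) : RP1), OnePoint.infty} :=
    Set.eq_of_subset_of_ncard_le hsub (by
      rw [hst.2, Set.ncard_pair (OnePoint.coe_ne_infty _)]) (by simp)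
  have h0 : ((0 : ℝ) : RP1) ∈ s.1 ∩ t.1 := by rw [heq]; simp
  have h1 : OnePoint.infty ∈ s.1 ∩ t.1 := by rw [heq]; simp
  rcases eq_or_eq_of_zero_mem_of_infty_mem h0.1 h1.1 with rfl | rfl
  · rcases eq_or_eq_of_zero_mem_of_infty_mem h0.2 h1.2 with rfl | rfl
    · exact absurd tri_one_subset ht
    · exact Sym2.eq_swap
  · exact absurd hs not_tri_S_subset

theorem fareyTree_isTree : fareyTree.IsTree := by
  refine ⟨fareyTree_connected, ?_⟩
  rw [SimpleGraph.isAcyclic_iff_forall_adj_isBridge]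
  intro s t h
  obtain ⟨A, rfl, rfl⟩ := exists_act_eq_of_adj h
  rw [SimpleGraph.isBridge_iff]
  intro hr
  refine not_tri_S_subset (branch_subset_posArc ((branch_map_iff (fareyAut A)).1 ?_))
  exact hr.symm

theorem fareyTree_valency (t : FareyTriangle) : (fareyTree.neighborSet t).ncard = 3 := by
  obtain ⟨A, rfl⟩ := exists_tri t
  have hS : fareyTree.neighborSet (tri 1) =
      {tri ModularGroup.S, tri ModularGroup.T, tri lowerU} := by
    ext t
    rw [SimpleGraph.mem_neighborSet, adj_tri_one_iff]
    simp
  have hA : fareyTree.neighborSet (tri A) = fareyAut A '' fareyTree.neighborSet (tri 1) := by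
    ext t
    constructor
    · intro h
      refine ⟨act A⁻¹ t, ?_, act_act_inv A t⟩
      rw [SimpleGraph.mem_neighborSet, ← act_adj A, act_act_inv, act_tri_one]
      exact h
    · rintro ⟨t, h, rfl⟩
      have := (act_adj A).2 h
      rwa [act_tri_one] at this
  rw [hA, Set.ncard_image_of_injective _ (fareyAut A).injective, hS, Set.ncard_eq_three]
  have hne : ∀ {s t : FareyTriangle} (x : RP1), x ∈ s.1 → x ∉ t.1 → s ≠ t := by
    rintro s _ x hs ht rfl
    exact ht hs
  refine ⟨_, _, _, hne ((-1 : ℝ) : RP1) ?_ ?_, hne ((-1 : ℝ) : RP1) ?_ ?_,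
    hne ((2 : ℝ) : RP1) ?_ ?_, rfl⟩ <;>
  norm_num [tri_S_val, tri_T_val, tri_lowerU_val, OnePoint.coe_eq_coe]

theorem moebius_S_mem_posArc {x : RP1} : moebius ModularGroup.S x ∈ posArc ↔ x ∈ negArc := by
  induction x using OnePoint.rec with
  | infty => simp [moebius_S_infty, coe_mem_posArc, infty_mem_negArc]
  | coe x =>
    rw [moebius_S_coe, coe_mem_negArc]
    split_ifs with h
    · simp [h, infty_mem_posArc]
    · simp [coe_mem_posArc]

/-- The branch at the reference triangle consists of the triangles lying over the arc `[0, ∞]`. -/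
theorem mem_branch_iff (t : FareyTriangle) :
    t ∈ branch fareyTree (tri ModularGroup.S) (tri 1) ↔ t.1 ⊆ posArc := by
  refine ⟨fun h => branch_subset_posArc h, fun h => ?_⟩
  refine (exists_mem_branch fareyTree_connected t).resolve_right fun h' => ?_
  have hS : act ModularGroup.S (tri ModularGroup.S) = tri 1 := by
    rw [← act_tri_one ModularGroup.S, act_S_S]
  have h2 := branch_map (fareyAut ModularGroup.S) h'
  simp only [fareyAut_apply, act_tri_one, hS] at h2
  refine not_subset_negArc_of_subset_posArc h fun x hx => moebius_S_mem_posArc.1 ?_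
  exact branch_subset_posArc h2 ⟨x, hx, rfl⟩

theorem mem_branch_act_iff (A : SL(2, ℤ)) (t : FareyTriangle) :
    t ∈ branch fareyTree (act A (tri ModularGroup.S)) (act A (tri 1)) ↔
      ∀ x ∈ t.1, moebius A⁻¹ x ∈ posArc := by
  rw [← act_act_inv A t]
  refine (branch_map_iff (fareyAut A)).trans ?_
  rw [mem_branch_iff, act_act_inv, act_val, Set.image_subset_iff]
  rfl

end FareyTree

/-! ### The embedding of the Thompson group -/

section Embedding

theorem moebius_eq_self_of_fixes {A : SL(2, ℤ)} (h : ∀ x ∈ baseSet, moebius A x = x) (x : RP1) :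
    moebius A x = x := by
  have h0 := h ((0 : ℝ) : RP1) (by simp [baseSet])
  have h1 := h ((1 : ℝ) : RP1) (by simp [baseSet])
  have h2 := h OnePoint.infty (by simp [baseSet])
  rw [moebius_zero_eq_frac, frac_eq_zero] at h0
  rw [moebius_infty_eq_frac, frac_eq_infty] at h2
  have hd : (A 1 1 : ℝ) ≠ 0 := by exact_mod_cast h0.2
  have hda : (A 0 0 : ℝ) = A 1 1 := by
    rw [moebius_coe] at h1
    simp only [h0.1, h2, Int.cast_zero, zero_add, add_zero, mul_one, if_neg hd,
      OnePoint.coe_eq_coe] at h1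
    rwa [div_eq_one_iff_eq hd] at h1
  induction x using OnePoint.rec with
  | infty => rw [moebius_infty_eq_frac, frac_eq_infty, h2]
  | coe x =>
    rw [moebius_coe]
    simp only [h0.1, h2, Int.cast_zero, zero_mul, zero_add, add_zero, if_neg hd,
      OnePoint.coe_eq_coe]
    rw [hda]
    field_simp

/-- A fractional linear transformation is determined by its values at the vertices of a Farey
triangle. -/
theorem moebius_eq_of_eqOn {A B : SL(2, ℤ)} {t : FareyTriangle}
    (h : ∀ x ∈ t.1, moebius A x = moebius B x) : moebius A = moebius B := by
  obtain ⟨C, rfl⟩ := exists_tri t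
  have key : ∀ x, moebius (C⁻¹ * B⁻¹ * A * C) x = x := by
    refine moebius_eq_self_of_fixes fun x hx => ?_
    rw [moebius_mul, moebius_mul, moebius_mul, h _ ⟨x, hx, rfl⟩, moebius_inv_moebius,
      moebius_inv_moebius]
  funext x
  have := key (moebius C⁻¹ x)
  rw [moebius_mul, moebius_mul, moebius_mul, moebius_moebius_inv] at this
  rw [← moebius_moebius_inv B (moebius A x), moebius_injective _ this]

theorem fareyAut_eq_of_moebius_eq {A B : SL(2, ℤ)} (h : moebius A = moebius B) :
    fareyAut A = fareyAut B := by
  refine RelIso.ext fun t => Subtype.ext ?_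
  rw [fareyAut_apply, fareyAut_apply, act_val, act_val, h]

/-- Near the end `ξ`, the transformation `f` of the projective line coincides with `A`: they agree
at the vertices of all the triangles of a branch containing `ξ`. -/
def HasGerm (f : RP1 ≃ₜ RP1) (ξ : Abs fareyTree) (A : SL(2, ℤ)) : Prop :=
  ∃ u w, fareyTree.Adj u w ∧ ξ ∈ ball fareyTree u w ∧
    ∀ t ∈ branch fareyTree u w, ∀ x ∈ t.1, f x = moebius A x

theorem HasGerm.fareyAut_eq {f : RP1 ≃ₜ RP1} {ξ : Abs fareyTree} {A B : SL(2, ℤ)}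
    (hA : HasGerm f ξ A) (hB : HasGerm f ξ B) : fareyAut A = fareyAut B := by
  obtain ⟨u, w, -, hξ, hA⟩ := hA
  obtain ⟨u', w', -, hξ', hB⟩ := hB
  obtain ⟨t, ht, ht'⟩ := nonempty_branch_inter_branch hξ hξ'
  exact fareyAut_eq_of_moebius_eq
    (moebius_eq_of_eqOn fun x hx => (hA t ht x hx).symm.trans (hB t ht' x hx))

theorem HasGerm.eventually {f : RP1 ≃ₜ RP1} {ξ : Abs fareyTree} {A : SL(2, ℤ)}
    (h : HasGerm f ξ A) : ∀ᶠ η in 𝓝 ξ, HasGerm f η A := by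
  obtain ⟨u, w, huw, hξ, hA⟩ := h
  filter_upwards [(isOpen_ball huw).mem_nhds hξ] with η hη
  exact ⟨u, w, huw, hη, hA⟩

theorem hasGerm_of_forall_eq {f : RP1 ≃ₜ RP1} {A : SL(2, ℤ)} (h : ∀ x, f x = moebius A x)
    (ξ : Abs fareyTree) : HasGerm f ξ A := by
  obtain ⟨u, w, huw, hξ⟩ := exists_mem_ball fareyTree_isTree ξ
  exact ⟨u, w, huw, hξ, fun _ _ x _ => h x⟩

theorem HasGerm.mul {f g : RP1 ≃ₜ RP1} {ξ : Abs fareyTree} {A B : SL(2, ℤ)}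
    (hg : HasGerm g ξ B) (hf : HasGerm f (absMap (fareyAut B) ξ) A) :
    HasGerm (f * g) ξ (A * B) := by
  obtain ⟨u, w, huw, hξ, hB⟩ := hg
  obtain ⟨u', w', huw', hξ', hA⟩ := hf
  have hξ'' : ξ ∈ ball fareyTree (act B⁻¹ u') (act B⁻¹ w') := by
    have := ball_map (fareyAut B⁻¹) hξ'
    rwa [← absMap_mul, ← map_mul, inv_mul_cancel, map_one, absMap_one] at this
  obtain ⟨x, y, hxy, hmem, hsub⟩ := exists_ball_subset_inter fareyTree_isTree hξ hξ''
  refine ⟨x, y, hxy, hmem, fun t ht p hp => ?_⟩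
  have h2 : act B t ∈ branch fareyTree u' w' := by
    have := branch_map (fareyAut B) (hsub ht).2
    simpa only [fareyAut_apply, act_act_inv] using this
  rw [Homeomorph.mul_apply, hB t (hsub ht).1 p hp, hA _ h2 _ ⟨p, hp, rfl⟩, moebius_mul]

theorem exists_moebius_infty {x : RP1} (hx : x ∈ rationalPoints) :
    ∃ A, x = moebius A OnePoint.infty := by
  unfold rationalPoints at hx
  rw [← isCusp_SL2Z_iff, isCusp_SL2Z_iff'] at hx
  obtain ⟨g, rfl⟩ := hx
  exact ⟨g, rfl⟩

theorem tendsto_coe_atTop : Tendsto ((↑) : ℝ → RP1) atTop (𝓝 OnePoint.infty) := by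
  refine OnePoint.tendsto_coe_infty.mono_left ?_
  rw [Filter.coclosedCompact_eq_cocompact]
  exact atTop_le_cocompact

theorem posArc_subset_closure : posArc ⊆ closure (((↑) : ℝ → RP1) '' Set.Ioi 0) := by
  intro x hx
  induction x using OnePoint.rec with
  | infty =>
    refine mem_closure_of_tendsto tendsto_coe_atTop ?_
    filter_upwards [eventually_gt_atTop 0] with y hy using ⟨y, hy, rfl⟩
  | coe x =>
    refine image_closure_subset_closure_image OnePoint.continuous_coe ⟨x, ?_, rfl⟩
    rw [closure_Ioi]
    exact coe_mem_posArc.1 hx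

/-- An element of the Thompson group has a germ at each end. A way leaves behind a triangle at each
of the break points, after which the open arcs under its branches contain no break points. -/
theorem IsPiecewisePSL.exists_hasGerm {f : RP1 ≃ₜ RP1} (hf : IsPiecewisePSL f)
    (ξ : Abs fareyTree) : ∃ A, HasGerm f ξ A := by
  obtain ⟨F, hF, hFQ, h⟩ := hf
  obtain ⟨a, rfl⟩ := Quotient.exists_rep ξ
  have hev : ∀ x ∈ F, ∀ᶠ n in atTop, ∃ t : FareyTriangle, x ∈ t.1 ∧
      t ∉ branch fareyTree (a.1 n) (a.1 (n + 1)) := by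
    intro x hx
    obtain ⟨C, hC⟩ := exists_moebius_infty (hFQ hx)
    filter_upwards [eventually_notMem_branch fareyTree_isTree a (tri C)] with n hn
    exact ⟨tri C, ⟨OnePoint.infty, by simp [baseSet], hC.symm⟩, hn⟩
  obtain ⟨n, hn⟩ := (hF.eventually_all.2 hev).exists
  obtain ⟨A, hA1, hA2⟩ := exists_act_eq_of_adj (a.2.1 n)
  have hJ : IsPreconnected (moebius A '' (((↑) : ℝ → RP1) '' Set.Ioi 0)) :=
    (isPreconnected_Ioi.image _ OnePoint.continuous_coe.continuousOn).image _
      (continuous_moebius A).continuousOn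
  have hd : Disjoint (moebius A '' (((↑) : ℝ → RP1) '' Set.Ioi 0)) F := by
    rw [Set.disjoint_left]
    rintro _ ⟨_, ⟨r, hr, rfl⟩, rfl⟩ hx
    obtain ⟨t, hxt, ht⟩ := hn _ hx
    rw [hA1, hA2, mem_branch_act_iff] at ht
    have hneg : (act A⁻¹ t).1 ⊆ negArc := by
      refine (subset_posArc_or_subset_negArc _).resolve_left fun hpos => ht fun y hy => ?_
      exact hpos ⟨y, hy, rfl⟩
    have := hneg ((mem_act_inv A t r).2 hxt)
    rw [coe_mem_negArc] at this
    exact absurd hr (not_lt.2 this)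
  obtain ⟨B, hB⟩ := h _ hJ hd
  refine ⟨B, _, _, a.2.1 n, toAbs_mem_ball fareyTree_isTree.isAcyclic a n, fun t ht x hx => ?_⟩
  rw [hA1, hA2, mem_branch_act_iff] at ht
  refine closure_minimal (t := {y | f y = moebius B y}) hB
    (isClosed_eq f.continuous (continuous_moebius B)) ?_
  exact image_closure_subset_closure_image (continuous_moebius A)
    ⟨_, posArc_subset_closure (ht x hx), moebius_moebius_inv A x⟩

/-- The action of an element of the Thompson group on the ends: it moves an end as its germ
does. -/
noncomputable def thompsonMap (f : thompson) (ξ : Abs fareyTree) : Abs fareyTree :=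
  absMap (fareyAut (f.2.exists_hasGerm ξ).choose) ξ

theorem thompsonMap_eq {f : thompson} {ξ : Abs fareyTree} {A : SL(2, ℤ)} (h : HasGerm f ξ A) :
    thompsonMap f ξ = absMap (fareyAut A) ξ := by
  rw [thompsonMap, (f.2.exists_hasGerm ξ).choose_spec.fareyAut_eq h]

theorem thompsonMap_of_forall_eq {f : thompson} {A : SL(2, ℤ)}
    (h : ∀ x, (f : RP1 ≃ₜ RP1) x = moebius A x) (ξ : Abs fareyTree) :
    thompsonMap f ξ = absMap (fareyAut A) ξ :=
  thompsonMap_eq (hasGerm_of_forall_eq h ξ)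

theorem thompsonMap_one (ξ : Abs fareyTree) : thompsonMap 1 ξ = ξ := by
  rw [thompsonMap_of_forall_eq (A := 1) fun x => (moebius_one x).symm, map_one, absMap_one]

theorem thompsonMap_mul (f g : thompson) (ξ : Abs fareyTree) :
    thompsonMap (f * g) ξ = thompsonMap f (thompsonMap g ξ) := by
  obtain ⟨B, hB⟩ := g.2.exists_hasGerm ξ
  obtain ⟨A, hA⟩ := f.2.exists_hasGerm (absMap (fareyAut B) ξ)
  rw [thompsonMap_eq hB, thompsonMap_eq hA, thompsonMap_eq (f := f * g) (hB.mul hA), map_mul,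
    absMap_mul]

theorem thompsonMap_eventuallyEq (f : thompson) (ξ : Abs fareyTree) :
    ∃ A, thompsonMap f =ᶠ[𝓝 ξ] absMap (fareyAut A) := by
  obtain ⟨A, hA⟩ := f.2.exists_hasGerm ξ
  exact ⟨A, hA.eventually.mono fun η hη => thompsonMap_eq hη⟩

theorem continuous_thompsonMap (f : thompson) : Continuous (thompsonMap f) := by
  rw [continuous_iff_continuousAt]
  intro ξ
  obtain ⟨A, hA⟩ := thompsonMap_eventuallyEq f ξ
  exact (continuous_absMap (fareyAut A)).continuousAt.congr hA.symm

/-- The embedding of the Thompson group in the group of spheromorphisms of the Farey tree. -/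
noncomputable def thompsonToHier : thompson →* hier fareyTree where
  toFun f :=
    ⟨{ toFun := thompsonMap f
       invFun := thompsonMap f⁻¹
       left_inv := fun ξ => by rw [← thompsonMap_mul, inv_mul_cancel, thompsonMap_one]
       right_inv := fun ξ => by rw [← thompsonMap_mul, mul_inv_cancel, thompsonMap_one]
       continuous_toFun := continuous_thompsonMap f
       continuous_invFun := continuous_thompsonMap f⁻¹ },
      fun ξ => (thompsonMap_eventuallyEq f ξ).imp' fareyAut fun _ h => h⟩
  map_one' := Subtype.ext (Homeomorph.ext thompsonMap_one)
  map_mul' f g := Subtype.ext (Homeomorph.ext (thompsonMap_mul f g))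

theorem thompsonToHier_apply (f : thompson) (ξ : Abs fareyTree) :
    (thompsonToHier f : Abs fareyTree ≃ₜ Abs fareyTree) ξ = thompsonMap f ξ := rfl

theorem thompsonToHier_of_forall_eq {f : thompson} {A : SL(2, ℤ)}
    (h : ∀ x, (f : RP1 ≃ₜ RP1) x = moebius A x) :
    thompsonToHier f = autToHier fareyTree (fareyAut A) :=
  Subtype.ext (Homeomorph.ext (thompsonMap_of_forall_eq h))

/-- The element of the Thompson group defined by a matrix. -/
noncomputable def moebiusThompson (A : SL(2, ℤ)) : thompson :=
  ⟨moebiusHom A, modularSubgroup_le_thompson ⟨A, rfl⟩⟩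

theorem thompsonToHier_moebiusThompson (A : SL(2, ℤ)) :
    thompsonToHier (moebiusThompson A) = autToHier fareyTree (fareyAut A) :=
  thompsonToHier_of_forall_eq fun _ => rfl

theorem moebiusThompson_mem (A : SL(2, ℤ)) : moebiusThompson A ∈ thompsonPSL := ⟨A, rfl⟩

theorem exists_eq_moebiusThompson {f : thompson} (hf : f ∈ thompsonPSL) :
    ∃ A, f = moebiusThompson A := by
  obtain ⟨A, hA⟩ := hf
  exact ⟨A, Subtype.ext hA.symm⟩

theorem LiesOver.map {ξ : Abs fareyTree} {p : RP1} (h : LiesOver ξ p) (A : SL(2, ℤ)) :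
    LiesOver (absMap (fareyAut A) ξ) (moebius A p) := by
  obtain ⟨a, rfl, ha⟩ := h
  refine ⟨a.map (fareyAut A), rfl, fun N hN => ?_⟩
  filter_upwards [ha _ ((continuous_moebius A).continuousAt hN)] with i hi
  exact Set.image_subset_iff.2 hi

theorem FareyTriangle.nonempty (t : FareyTriangle) : t.1.Nonempty := by
  obtain ⟨A, rfl⟩ := exists_tri t
  exact ⟨_, OnePoint.infty, by simp [baseSet], rfl⟩

theorem LiesOver.eq_of_hasGerm {f : RP1 ≃ₜ RP1} {ξ : Abs fareyTree} {p : RP1} {A : SL(2, ℤ)}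
    (h : LiesOver ξ p) (hA : HasGerm f ξ A) : f p = moebius A p := by
  obtain ⟨a, rfl, ha⟩ := h
  obtain ⟨u, w, -, hξ, hA⟩ := hA
  refine (isClosed_eq f.continuous (continuous_moebius A)).closure_subset
    (mem_closure_iff_nhds.2 fun N hN => ?_)
  obtain ⟨n, h1, h2⟩ := ((eventually_branch_subset fareyTree_isTree a hξ).and
    ((tendsto_add_atTop_nat 1).eventually (ha N hN))).exists
  obtain ⟨x, hx⟩ := FareyTriangle.nonempty (a.1 (n + 1))
  exact ⟨x, h2 hx, hA _ (h1 (self_mem_branch _ _)) x hx⟩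

theorem LiesOver.thompsonMap {ξ : Abs fareyTree} {p : RP1} (h : LiesOver ξ p) (f : thompson) :
    LiesOver (thompsonMap f ξ) ((f : RP1 ≃ₜ RP1) p) := by
  obtain ⟨A, hA⟩ := f.2.exists_hasGerm ξ
  rw [thompsonMap_eq hA, h.eq_of_hasGerm hA]
  exact h.map A

theorem LiesOver.unique {ξ : Abs fareyTree} {p q : RP1} (hp : LiesOver ξ p)
    (hq : LiesOver ξ q) : p = q := by
  by_contra hne
  obtain ⟨a, rfl, ha⟩ := hp
  obtain ⟨b, hb, hbq⟩ := hq
  obtain ⟨m, n, hmn⟩ := Quotient.exact hb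
  obtain ⟨N, N', hN, hN', hd⟩ := t2_separation_nhds hne
  obtain ⟨i, h1, h2⟩ := ((((tendsto_add_atTop_nat n).eventually (ha N hN))).and
    ((tendsto_add_atTop_nat m).eventually (hbq N' hN'))).exists
  rw [add_comm] at h1 h2
  rw [hmn i] at h2
  obtain ⟨x, hx⟩ := FareyTriangle.nonempty (a.1 (n + i))
  exact Set.disjoint_left.1 hd (h1 hx) (h2 hx)

theorem moebius_T_pow_coe (n : ℕ) (x : ℝ) :
    moebius (ModularGroup.T ^ n) (x : RP1) = ((x + n : ℝ) : RP1) := by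
  induction n with
  | zero => simp [moebius_one]
  | succ n ih => rw [pow_succ', moebius_mul, ih, moebius_T_coe]; push_cast; rw [add_assoc]

theorem moebius_T_pow_infty (n : ℕ) :
    moebius (ModularGroup.T ^ n) OnePoint.infty = OnePoint.infty := by
  induction n with
  | zero => simp [moebius_one]
  | succ n ih => rw [pow_succ', moebius_mul, ih, moebius_T_infty]

theorem tri_T_pow_val (n : ℕ) : (tri (ModularGroup.T ^ n)).1 =
    {((n : ℝ) : RP1), ((1 + n : ℝ) : RP1), OnePoint.infty} := by
  simp only [tri, baseSet, Set.image_insert_eq, Set.image_singleton, moebius_T_pow_coe,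
    moebius_T_pow_infty, zero_add]

/-- The way passing through the triangles with vertices `n`, `n + 1`, `∞`. -/
noncomputable def fanWay : Way fareyTree :=
  ⟨fun n => tri (ModularGroup.T ^ n), fun n => by
    have := (act_adj (ModularGroup.T ^ n)).2 adj_tri_one_T
    rwa [act_tri_one, act_tri, ← pow_succ] at this, fun n h => by
    have h1 : ((n : ℝ) : RP1) ∈ (tri (ModularGroup.T ^ (n + 2))).1 := by
      rw [show tri (ModularGroup.T ^ (n + 2)) = tri (ModularGroup.T ^ n) from h, tri_T_pow_val]
      simp
    rw [tri_T_pow_val] at h1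
    simp only [Set.mem_insert_iff, Set.mem_singleton_iff, OnePoint.coe_eq_coe,
      OnePoint.coe_ne_infty, or_false] at h1
    push_cast at h1
    rcases h1 with h1 | h1 <;> linarith⟩

theorem liesOver_fanWay : LiesOver fanWay.toAbs OnePoint.infty := by
  refine ⟨fanWay, rfl, fun N hN => ?_⟩
  have h1 : ∀ᶠ n : ℕ in atTop, ((n : ℝ) : RP1) ∈ N :=
    (tendsto_coe_atTop.comp tendsto_natCast_atTop_atTop).eventually hN
  filter_upwards [h1, (tendsto_add_atTop_nat 1).eventually h1] with n hn hn'
  change (tri _).1 ⊆ N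
  rw [tri_T_pow_val, Set.insert_subset_iff, Set.insert_subset_iff, Set.singleton_subset_iff]
  refine ⟨hn, ?_, mem_of_mem_nhds hN⟩
  rwa [Nat.cast_add, Nat.cast_one, add_comm] at hn'

theorem exists_liesOver {p : RP1} (hp : p ∈ rationalPoints) : ∃ ξ, LiesOver ξ p := by
  obtain ⟨A, rfl⟩ := exists_moebius_infty hp
  exact ⟨_, liesOver_fanWay.map A⟩

/-- An element of the Thompson group acting trivially on the ends fixes the points under them, in
particular the dense set of rational points. -/
theorem thompsonToHier_injective : Function.Injective thompsonToHier := by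
  rw [injective_iff_map_eq_one]
  intro f hf
  have hrat : ∀ q : ℚ, (f : RP1 ≃ₜ RP1) ((q : ℝ) : RP1) = ((q : ℝ) : RP1) := by
    intro q
    obtain ⟨ξ, hξ⟩ := exists_liesOver (p := ((q : ℝ) : RP1)) ⟨(q : OnePoint ℚ), rfl⟩
    have h1 := hξ.thompsonMap f
    rw [← thompsonToHier_apply, hf] at h1
    exact LiesOver.unique h1 hξ
  have hdense : DenseRange fun q : ℚ => ((q : ℝ) : RP1) :=
    OnePoint.denseRange_coe.comp Rat.denseRange_cast OnePoint.continuous_coe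
  have := hdense.equalizer (f : RP1 ≃ₜ RP1).continuous continuous_id (funext hrat)
  exact Subtype.ext (Homeomorph.ext fun x => congrFun this x)

end Embedding

/-! ### Vectors fixed by the modular group -/

section Fixed

theorem exists_act_T_pow_subset (t : FareyTriangle) :
    ∀ᶠ n : ℕ in atTop, (act (ModularGroup.T ^ n) t).1 ⊆ posArc := by
  have hfin : t.1.Finite := by
    obtain ⟨A, rfl⟩ := exists_tri t
    exact (Set.Finite.image _ (by simp [baseSet]))
  have hx : ∀ x ∈ t.1, ∀ᶠ n : ℕ in atTop, moebius (ModularGroup.T ^ n) x ∈ posArc := by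
    intro x _
    induction x using OnePoint.rec with
    | infty =>
      refine Eventually.of_forall fun n => ?_
      rw [moebius_T_pow_infty]
      exact infty_mem_posArc
    | coe x =>
      filter_upwards [tendsto_natCast_atTop_atTop.eventually (eventually_ge_atTop (-x))] with n hn
      rw [moebius_T_pow_coe, coe_mem_posArc]
      linarith
  filter_upwards [hfin.eventually_all.2 hx] with n hn
  exact Set.image_subset_iff.2 hn

/-- The modular group moves any finite set of triangles into any branch. -/
theorem exists_act_mem_branch {u w : FareyTriangle} (h : fareyTree.Adj u w)
    (S : Finset FareyTriangle) : ∃ A, ∀ t ∈ S, act A t ∈ branch fareyTree u w := by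
  obtain ⟨A, rfl, rfl⟩ := exists_act_eq_of_adj h
  obtain ⟨n, hn⟩ := ((Finset.eventually_all S).2 fun t _ => exists_act_T_pow_subset t).exists
  refine ⟨A * ModularGroup.T ^ n, fun t ht => ?_⟩
  rw [act_mul]
  exact branch_map (fareyAut A) ((mem_branch_iff _).2 (hn t ht))

variable {H : Type*} [NormedAddCommGroup H] [InnerProductSpace ℂ H]

/-- A vector fixed by the modular group is fixed by each automorphism that fixes a branch
pointwise: conjugation by the modular group moves such an automorphism arbitrarily close to the
identity, without changing the displacement of the vector. -/
theorem fixed_of_fixes_branch (ρ : hier fareyTree →* (H ≃ₗᵢ[ℂ] H)) {w : H}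
    (hcont : Continuous fun g => ρ g w)
    (hw : ∀ A, ρ (autToHier fareyTree (fareyAut A)) w = w) {u x : FareyTriangle}
    (hux : fareyTree.Adj u x) {r : fareyTree ≃g fareyTree}
    (hr : ∀ t ∈ branch fareyTree u x, r t = t) : ρ (autToHier fareyTree r) w = w := by
  rw [← sub_eq_zero, ← norm_le_zero_iff]
  refine le_of_forall_pos_lt_add fun ε hε => ?_
  have hopen : IsOpen {g | ‖ρ g w - w‖ < ε} :=
    isOpen_lt (hcont.sub continuous_const).norm continuous_const
  obtain ⟨S, hS⟩ := hopen 1 (by simpa using hε)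
  obtain ⟨A, hA⟩ := exists_act_mem_branch hux S
  have hfix : ∀ t ∈ S, ((fareyAut A)⁻¹ * r * fareyAut A) t = t := by
    intro t ht
    rw [RelIso.mul_apply, RelIso.mul_apply, fareyAut_apply, hr _ (hA t ht), ← fareyAut_apply,
      RelIso.inv_apply_self]
  have h := hS _ hfix
  rw [one_mul, Set.mem_ofPred_eq, map_mul, map_mul, map_mul, map_mul, ← map_inv (fareyAut)] at h
  simp only [LinearIsometryEquiv.coe_mul, Function.comp_apply, hw] at h
  nth_rw 2 [← hw A⁻¹] at h
  rwa [← map_sub, LinearIsometryEquiv.norm_map, ← zero_add ε] at h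

/-- A vector fixed by the modular group is fixed by all automorphisms of the tree: modulo the
modular group an automorphism fixes an edge, and then it is a product of automorphisms fixing
branches pointwise. -/
theorem fixed_by_aut (ρ : hier fareyTree →* (H ≃ₗᵢ[ℂ] H)) {w : H}
    (hcont : Continuous fun g => ρ g w)
    (hw : ∀ A, ρ (autToHier fareyTree (fareyAut A)) w = w) (r : fareyTree ≃g fareyTree) :
    ρ (autToHier fareyTree r) w = w := by
  obtain ⟨A, h1, h2⟩ := exists_act_eq_of_adj (r.map_adj_iff.2 adj_tri_S_one)
  obtain ⟨r₁, r₂, h, hr₁, hr₂⟩ := exists_mul_eq_of_fixes_edge fareyTree_isTree.isAcyclic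
    adj_tri_S_one ((fareyAut A)⁻¹ * r)
    (by rw [RelIso.mul_apply, h1, ← fareyAut_apply, RelIso.inv_apply_self])
    (by rw [RelIso.mul_apply, h2, ← fareyAut_apply, RelIso.inv_apply_self])
  rw [inv_mul_eq_iff_eq_mul] at h
  rw [h, map_mul, map_mul, map_mul, map_mul]
  simp only [LinearIsometryEquiv.coe_mul, Function.comp_apply]
  rw [fixed_of_fixes_branch ρ hcont hw adj_tri_S_one hr₂,
    fixed_of_fixes_branch ρ hcont hw adj_tri_one_S hr₁, hw]

end Fixed

/-! ### Irreducibility of the cyclic span -/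

section Irreducible

variable {G : Type*} [Group G]
variable {H : Type*} [NormedAddCommGroup H] [InnerProductSpace ℂ H]

theorem inner_map_left (ρ : G →* (H ≃ₗᵢ[ℂ] H)) (g : G) (x y : H) :
    inner ℂ (ρ g x) y = inner ℂ x (ρ g⁻¹ y) := by
  rw [← LinearIsometryEquiv.inner_map_map (ρ g) x (ρ g⁻¹ y), ← Function.comp_apply (f := ρ g),
    ← LinearIsometryEquiv.coe_mul, ← map_mul, mul_inv_cancel, map_one]
  rfl

/-- A unitary representation with a cyclic vector `v` is irreducible if `v` is the only vector
fixed by a subgroup `K`, up to scalars: the projection of `v` to an invariant subspace is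
`K`-fixed, so it is a multiple of `v`. -/
theorem eq_bot_or_eq_top_of_cyclic [CompleteSpace H] (ρ : G →* (H ≃ₗᵢ[ℂ] H)) (K : Subgroup G)
    {v : H} (hcyc : ∀ y, (∀ g, inner ℂ (ρ g v) y = 0) → y = 0) (hfix : ∀ k ∈ K, ρ k v = v)
    (huniq : ∀ w, (∀ k ∈ K, ρ k w = w) → ∃ c : ℂ, w = c • v) (W : Submodule ℂ H)
    (hW : IsClosed (W : Set H)) (hinv : InvariantUnder ρ W) : W = ⊥ ∨ W = ⊤ := by
  have : CompleteSpace W := hW.completeSpace_coe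
  have hp : ∀ k ∈ K, ρ k (W.starProjection v) = W.starProjection v := by
    intro k hk
    refine (Submodule.eq_starProjection_of_mem_of_inner_eq_zero
      (hinv k _ (Submodule.starProjection_apply_mem W v)) fun w hw => ?_).symm
    nth_rw 1 [← hfix k hk]
    rw [← map_sub, inner_map_left]
    exact Submodule.starProjection_inner_eq_zero v _ (hinv _ w hw)
  obtain ⟨c, hc⟩ := huniq _ hp
  by_cases h0 : c = 0
  · left
    rw [h0, zero_smul, Submodule.starProjection_apply_eq_zero_iff] at hc
    rw [Submodule.eq_bot_iff]
    intro w hw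
    refine hcyc w fun g => ?_
    rw [inner_map_left]
    exact Submodule.inner_left_of_mem_orthogonal (hinv _ w hw) hc
  · right
    have hv : v ∈ W := by
      have := W.smul_mem c⁻¹ (Submodule.starProjection_apply_mem W v)
      rwa [hc, smul_smul, inv_mul_cancel₀ h0, one_smul] at this
    rw [← Submodule.orthogonal_eq_bot_iff, Submodule.eq_bot_iff]
    exact fun y hy => hcyc y fun g => Submodule.inner_right_of_mem_orthogonal (hinv g v hv) hy

theorem eq_zero_of_inner_cyclicRep_eq_zero (ρ : G →* (H ≃ₗᵢ[ℂ] H)) (v : H)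
    (y : cyclicSpan ρ v)
    (h : ∀ g, inner ℂ (cyclicRep ρ v g ⟨v, mem_cyclicSpan ρ v⟩) y = 0) : y = 0 := by
  have hy : (y : H) ∈ (cyclicSpan ρ v)ᗮ := by
    change (y : H) ∈ (Submodule.topologicalClosure _)ᗮ
    rw [Submodule.orthogonal_closure, Submodule.mem_orthogonal]
    intro x hx
    induction hx using Submodule.span_induction with
    | mem x hx =>
      obtain ⟨g, rfl⟩ := hx
      exact h g
    | zero => exact inner_zero_left _
    | add x x' _ _ hx hx' => rw [inner_add_left, hx, hx', add_zero]
    | smul c x _ hx => rw [inner_smul_left, hx, mul_zero]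
  exact Subtype.ext (inner_self_eq_zero.1 (Submodule.inner_right_of_mem_orthogonal y.2 hy))

end Irreducible

theorem propositionA :
    -- the tree dual to the Farey triangulation is the tree all of whose vertices have valency 3
    (fareyTree.IsTree ∧ ∀ t, (fareyTree.neighborSet t).ncard = 3) ∧
    -- the embedding of the Thompson group in the group of spheromorphisms: the spheromorphism
    -- corresponding to `f` acts as `f` on the projective line, and `PSL(2, ℤ)` goes to `Aut`
    ∃ ι : thompson →* hier fareyTree,
      Function.Injective ι ∧
      (∀ (f : thompson) (ξ : Abs fareyTree) (p : RP1),
        LiesOver ξ p → LiesOver ((ι f : Abs fareyTree ≃ₜ Abs fareyTree) ξ)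
          ((f : RP1 ≃ₜ RP1) p)) ∧
      (∀ f ∈ thompsonPSL, ι f ∈ autSubgroup fareyTree) ∧
      -- the cyclic span of a spherical vector
      ∀ (H : Type*) [NormedAddCommGroup H] [InnerProductSpace ℂ H] [CompleteSpace H]
        (ρ : hier fareyTree →* (H ≃ₗᵢ[ℂ] H)) (v : H),
        IsSpherical ρ (autSubgroup fareyTree) v →
        IsSpherical (cyclicRep (ρ.comp ι) v) thompsonPSL ⟨v, mem_cyclicSpan (ρ.comp ι) v⟩ := by
  have hAut : ∀ f ∈ thompsonPSL, thompsonToHier f ∈ autSubgroup fareyTree := by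
    intro f hf
    obtain ⟨A, rfl⟩ := exists_eq_moebiusThompson hf
    exact ⟨fareyAut A, (thompsonToHier_moebiusThompson A).symm⟩
  refine ⟨⟨fareyTree_isTree, fareyTree_valency⟩, thompsonToHier, thompsonToHier_injective,
    fun f ξ p h => h.thompsonMap f, hAut, ?_⟩
  intro H _ _ _ ρ v hρ
  have hfix : ∀ k ∈ thompsonPSL, cyclicRep (ρ.comp thompsonToHier) v k
      ⟨v, mem_cyclicSpan (ρ.comp thompsonToHier) v⟩ =
      ⟨v, mem_cyclicSpan (ρ.comp thompsonToHier) v⟩ :=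
    fun k hk => Subtype.ext (hρ.fixed _ (hAut k hk))
  have huniq : ∀ w : cyclicSpan (ρ.comp thompsonToHier) v,
      (∀ k ∈ thompsonPSL, cyclicRep (ρ.comp thompsonToHier) v k w = w) →
      ∃ c : ℂ, w = c • ⟨v, mem_cyclicSpan (ρ.comp thompsonToHier) v⟩ := by
    intro w hw
    have hA : ∀ A, ρ (autToHier fareyTree (fareyAut A)) (w : H) = w := fun A => by
      rw [← thompsonToHier_moebiusThompson]
      exact congrArg Subtype.val (hw _ (moebiusThompson_mem A))
    obtain ⟨c, hc⟩ := hρ.unique w (by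
      rintro _ ⟨r, rfl⟩
      exact fixed_by_aut ρ (hρ.continuous w) hA r)
    exact ⟨c, Subtype.ext hc⟩
  have : DiscreteTopology thompson := ⟨rfl⟩
  exact
    { continuous := fun _ => continuous_of_discreteTopology
      irreducible := eq_bot_or_eq_top_of_cyclic _ thompsonPSL
        (eq_zero_of_inner_cyclicRep_eq_zero _ v) hfix huniq
      ne_zero := fun h => hρ.ne_zero (congrArg Subtype.val h)
      fixed := hfix
      unique := huniq }
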